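/- Let $\mathcal H$ and $V$ be separable (real or complex) Hilbert spaces, $T>0$, $q\ge 1$. Let $L:D(L)\subset\mathcal H\to\mathcal H$ be the infinitesimal generator of a $C_0$-semigroup $T(t)$ on $\mathcal H$ with $\|T(t)\|\le Me^{\omega t}$ for $t\ge 0$, where $M\ge1$, $\omega\ge 0$. Let $F:\mathcal H\to\mathcal H$ be Lipschitz on every ball centred at the origin, and let $\mathfrak C:V\to\mathcal H$ be continuous with $\mathfrak C(0)=0$. Let $U\subset V$ be compact, and put $$\mathcal U_{ad}=\{u\in L^q(0,T;V): u(s)\in U \text{ for a.e. } s\in[0,T]\},\qquad \mathcal U_{ad}[t,T]=\{u|_{[t,T]}:u\in\mathcal U_{ad}\}.$$ Let $(\mathcal H_N)_{N\ge1}$ be finite-dimensional subspaces of $\mathcal H$ contained in $D(L)$, with orthogonal projectors $\Pi_N:\mathcal H\to\mathcal H_N$ such that $\Pi_Nx\to x$ for every $x\in\mathcal H$, and put $L_N=\Pi_NL\Pi_N$. For $t\in[0,T]$, $x\in\mathcal H$, $u\in\mathcal U_{ad}[t,T]$, a mild solution over $[t,T]$ of $\frac{dy}{ds}=Ly+F(y)+\mathfrak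 C(u(s))$, $y(t)=x$, is a $y\in C([t,T],\mathcal H)$ with $$y(s)=T(s-t)x+\int_t^sT(s-r)F(y(r))\,dr+\int_t^sT(s-r)\mathfrak C(u(r))\,dr,\qquad s\in[t,T];$$ it is denoted by $y_{t,x}(\cdot;u)$. The solution in $C([t,T],\mathcal H_N)$ (in the integrated sense) of the Galerkin approximation $\frac{dy_N}{ds}=L_Ny_N+\Pi_NF(y_N)+\Pi_N\mathfrak C(u(s))$, $y_N(t)=\Pi_Nx$, is denoted by $y^N_{t,\Pi_Nx}(\cdot;u)$. Assume moreover: 1. (stability) for each $N$, the flow $e^{L_Nt}:\mathcal H_N\to\mathcal H_N$ extends to a $C_0$-semigroup $T_N(t)$ on $\mathcal H$ with $\|T_N(t)\|\le Me^{\omega t}$ for all $t\ge0$, with the same $M,\omega$ as above; 2. (consistency) $\|L_N\phi-L\phi\|_{\mathcal H}\to0$ as $N\to\infty$ for every $\phi\in D(L)$; 3. (well-posedness and uniform bounds) for every $x\in\mathcal H$, $u\in\mathcal U_{ad}$ and $N\ge1$, the mild solution $y_{0,x}(\cdot;u)$ and the Galerkin solution $y^N_{0,\Pi_Nx}(\cdot;u)$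 over $[0,T]$ exist and are unique, and for every $x\in\mathcal H$ there is a constant $\mathcal C=\mathcal C(T,x)$ such that $\|y_{0,x}(s;u)\|_{\mathcal H}\le\mathcal C$ and $\|y^N_{0,\Pi_Nx}(s;u)\|_{\mathcal H}\le\mathcal C$ for all $s\in[0,T]$, $N\ge1$, $u\in\mathcal U_{ad}$; 4. (residual energy) for every $x\in\mathcal H$, $\displaystyle\lim_{N\to\infty}\sup_{u\in\mathcal U_{ad}}\sup_{s\in[0,T]}\|(\mathrm{Id}_{\mathcal H}-\Pi_N)\,y_{0,x}(s;u)\|_{\mathcal H}=0$. Then, for every $x\in\mathcal H$, the solutions $y_{t,x}(\cdot;u)$ and $y^N_{t,\Pi_Nx}(\cdot;u)$ exist and are unique over $[t,T]$ for all $t\in[0,T]$, $u\in\mathcal U_{ad}[t,T]$ and $N\ge1$, and $$\lim_{N\to\infty}\ \sup_{t\in[0,T]}\ \sup_{u\in\mathcal U_{ad}[t,T]}\ \sup_{s\in[t,T]}\|y^N_{t,\Pi_Nx}(s;u)-y_{t,x}(s;u)\|_{\mathcal H}=0.$$ -/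

import Mathlib

open Set Filter Topology MeasureTheory
open scoped NNReal ENNReal

namespace GalerkinControl

section Semigroups

variable {𝕜 H : Type*} [RCLike 𝕜] [NormedAddCommGroup H] [InnerProductSpace 𝕜 H]

/-- `S` restricted to `[0, ∞)` is a `C₀`-semigroup of bounded linear operators on `H`.
Values at negative times are irrelevant and never used. -/
structure IsC0Semigroup (S : ℝ → H →L[𝕜] H) : Prop where
  zero : S 0 = ContinuousLinearMap.id 𝕜 H
  add : ∀ s t : ℝ, 0 ≤ s → 0 ≤ t → S (s + t) = (S s).comp (S t)
  continuous_at_zero : ∀ x : H, Tendsto (fun t => S t x) (𝓝[>] 0) (𝓝 x)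

/-- The unbounded operator `L : D(L) ⊂ H → H` is the infinitesimal generator of `S`:
`x ∈ D(L)` and `L x = y` exactly when `(S h x - x) / h → y` as `h ↓ 0`. -/
def IsGenerator (S : ℝ → H →L[𝕜] H) (L : H →ₗ.[𝕜] H) : Prop :=
  ∀ x y : H, (∃ hx : x ∈ L.domain, L ⟨x, hx⟩ = y) ↔
    Tendsto (fun h : ℝ => ((h⁻¹ : ℝ) : 𝕜) • (S h x - x)) (𝓝[>] 0) (𝓝 y)

/-- The Galerkin operator `Π_K L Π_K`, where `K ⊂ D(L)` is finite-dimensional and `Π_K` is the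
orthogonal projector onto `K`. It is a bounded operator, defined on all of `H`. -/
noncomputable def galerkinOp (L : H →ₗ.[𝕜] H) (K : Submodule 𝕜 H) [FiniteDimensional 𝕜 K]
    (hK : K ≤ L.domain) : H →L[𝕜] H :=
  (K.starProjection.comp
    (LinearMap.toContinuousLinearMap (L.toFun.comp (Submodule.inclusion hK)))).comp
      K.orthogonalProjectionOnto

end Semigroups

/-- Locally Lipschitz in the sense: Lipschitz on every ball centred at the origin. -/
def LipschitzOnBalls {E E' : Type*} [SeminormedAddCommGroup E] [SeminormedAddCommGroup E']
    (f : E → E') : Prop :=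
  ∀ r : ℝ, 0 < r → ∃ K : ℝ≥0, LipschitzOnWith K f (Metric.closedBall 0 r)

section Controls

variable {V : Type*} [NormedAddCommGroup V]

/-- The admissible controls: (representatives of) elements `u` of `L^q(0, T; V)` such that
`u s ∈ U` for almost every `s ∈ [0, T]`. -/
def admissible (q : ℝ≥0∞) (U : Set V) (T : ℝ) : Set (ℝ → V) :=
  {u | MemLp u q (volume.restrict (Icc 0 T)) ∧ ∀ᵐ s ∂(volume.restrict (Icc 0 T)), u s ∈ U}

/-- The restrictions to `[t, T]` of the admissible controls: (representatives of) functions that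
agree almost everywhere on `[t, T]` with an admissible control. -/
def admissibleOn (q : ℝ≥0∞) (U : Set V) (t T : ℝ) : Set (ℝ → V) :=
  {w | ∃ u ∈ admissible q U T, w =ᵐ[volume.restrict (Icc t T)] u}

end Controls

section Solutions

variable {𝕜 H V : Type*} [RCLike 𝕜] [NormedAddCommGroup H] [InnerProductSpace 𝕜 H]
  [NormedSpace ℝ H]

/-- `y` is a mild solution over `[t, T]` of `dy/ds = L y + F(y) + C(u(s))`, `y(t) = x`, where `L`
generates the semigroup `S`. Only the values of `y` on `[t, T]` matter. -/
structure IsMildSolution (S : ℝ → H →L[𝕜] H) (F : H → H) (C : V → H) (t T : ℝ) (x : H)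
    (u : ℝ → V) (y : ℝ → H) : Prop where
  continuousOn : ContinuousOn y (Icc t T)
  eq : ∀ s ∈ Icc t T, y s = S (s - t) x + (∫ r in t..s, S (s - r) (F (y r)))
    + ∫ r in t..s, S (s - r) (C (u r))

/-- `y` is a continuous, `K`-valued solution over `[t, T]` (in the integrated, i.e. Carathéodory,
sense) of the Galerkin approximation
`dy/ds = L_K y + Π_K F(y) + Π_K C(u(s))`, `y(t) = Π_K x`, with `L_K = Π_K L Π_K`.
Only the values of `y` on `[t, T]` matter. -/
structure IsGalerkinSolution (L : H →ₗ.[𝕜] H) (K : Submodule 𝕜 H) [FiniteDimensional 𝕜 K]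
    (hK : K ≤ L.domain) (F : H → H) (C : V → H) (t T : ℝ) (x : H)
    (u : ℝ → V) (y : ℝ → H) : Prop where
  continuousOn : ContinuousOn y (Icc t T)
  mem : ∀ s ∈ Icc t T, y s ∈ K
  eq : ∀ s ∈ Icc t T, y s = K.starProjection x
    + ∫ r in t..s, (galerkinOp L K hK (y r) + K.starProjection (F (y r))
        + K.starProjection (C (u r)))

/-- There is a function satisfying `P`, and it is unique as a function on `[t, T]`. -/
def ExistsUniqueOn (t T : ℝ) (P : (ℝ → H) → Prop) : Prop :=
  (∃ y, P y) ∧ ∀ y₁ y₂, P y₁ → P y₂ → EqOn y₁ y₂ (Icc t T)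

end Solutions

end GalerkinControl

open GalerkinControl

/-! The equation is autonomous apart from the control. A problem started at time `t` is therefore a
translate of one started at `0`, driven by the shifted control, which is extended to `[0, T]` by a
constant value in `U`. This absorbs the supremum over `t`, and only uniformity in `u` on `[0, T]`
remains.

There, write `P = e^{L_N t}` and `Q = Π_N`. Subtracting the variation of constants formula for `y_N`
from the mild formula for `y` gives the errors `S - PQ` applied to `x`, `F(y)` and `C(u)`, plus
`PQ(F(y) - F(y_N))`. The uniform bounds give one Lipschitz constant for all `u` and `N`, so Grönwall
reduces the claim to `S(t)z - P(t)Qz → 0`, uniformly for `t ∈ [0, T]` and `z ∈ {x} ∪ F(Y) ∪ C(U)`,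
where `Y` is the set of all values of all trajectories from `x`.

For fixed `z` this is Trotter–Kato (`trotter_kato`), proved by Duhamel's formula on `D(L)` and
density. Since `S - PQ` is equi-Lipschitz in `z`, the convergence is uniform on totally bounded sets
(`eventually_norm_le_of_totallyBounded`). `C(U)` is compact, and the residual energy hypothesis
makes `Y` totally bounded: up to `ε` it lies in a bounded part of some finite-dimensional `H_N`
(`totallyBounded_of_residual`). -/

namespace GalerkinControl

/-! ### Grönwall's inequality. -/

section Gronwall

/-- Grönwall's inequality in integral form. -/
theorem le_mul_exp_of_le_add_integral {φ : ℝ → ℝ} {a b t T : ℝ} (hb : 0 < b)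
    (hφ : ContinuousOn φ (Icc t T)) (hφ0 : ∀ s ∈ Icc t T, 0 ≤ φ s)
    (h : ∀ s ∈ Icc t T, φ s ≤ a + b * ∫ r in t..s, φ r) :
    ∀ s ∈ Icc t T, φ s ≤ a * Real.exp (b * (s - t)) := by
  intro s hs
  have htT : t ≤ T := hs.1.trans hs.2
  have hint : IntervalIntegrable φ volume t T := hφ.intervalIntegrable_of_Icc htT
  have hpos : ∀ r ∈ Icc t T, 0 ≤ ∫ τ in t..r, φ τ := fun r hr =>
    intervalIntegral.integral_nonneg hr.1 fun τ hτ => hφ0 τ ⟨hτ.1, hτ.2.trans hr.2⟩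
  -- The differential Grönwall bound is applied to the primitive `Φ` of `φ`: `Φ(t) = 0` and its
  -- right derivative `φ` is at most `bΦ + a`. The bound on `Φ` is then put back into `h`.
  have key := norm_le_gronwallBound_of_norm_deriv_right_le (f := fun r => ∫ τ in t..r, φ τ)
    (f' := φ) (δ := 0) (K := b) (ε := a) (a := t) (b := T) ?_ ?_ (by simp) ?_ s hs
  · rw [gronwallBound_of_K_ne_0 hb.ne', Real.norm_of_nonneg (hpos s hs)] at key
    have h1 := h s hs
    have h2 := mul_le_mul_of_nonneg_left key hb.le
    have h3 : b * (0 * Real.exp (b * (s - t)) + a / b * (Real.exp (b * (s - t)) - 1))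
        = a * Real.exp (b * (s - t)) - a := by field_simp; ring
    linarith
  · have := intervalIntegral.continuousOn_primitive_interval (μ := volume) (f := φ) (a := t) (b := T)
      (by rw [uIcc_of_le htT]; exact hφ.integrableOn_Icc)
    rwa [uIcc_of_le htT] at this
  · intro r hr
    have hr' : r ∈ Icc t T := ⟨hr.1, hr.2.le⟩
    have hmem : Icc t T ∈ 𝓝[>] r := by
      refine mem_of_superset (Ioo_mem_nhdsGT hr.2) fun τ hτ => ⟨hr.1.trans hτ.1.le, hτ.2.le⟩
    refine intervalIntegral.integral_hasDerivWithinAt_right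
      ((hφ.mono (Icc_subset_Icc_right hr.2.le)).intervalIntegrable_of_Icc hr.1) ?_
      (t := Ioi r) ?_
    · exact ⟨Icc t T, hmem, hφ.aestronglyMeasurable measurableSet_Icc⟩
    · exact (hφ r hr').mono_of_mem_nhdsWithin hmem
  · intro r hr
    have hr' : r ∈ Icc t T := ⟨hr.1, hr.2.le⟩
    rw [Real.norm_of_nonneg (hφ0 r hr'), Real.norm_of_nonneg (hpos r hr')]
    linarith [h r hr']

end Gronwall

/-! ### Uniform convergence on totally bounded sets. -/

section OperatorFamilies

variable {ι E E' : Type*} [NormedAddCommGroup E] [NormedAddCommGroup E']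

/-- Equi-Lipschitz maps that tend to zero pointwise, uniformly in a parameter, do so uniformly on
totally bounded sets. -/
theorem eventually_norm_le_of_totallyBounded {B : ℕ → ι → E → E'} {b : ℝ}
    (hB : ∀ N i z z', ‖B N i z - B N i z'‖ ≤ b * ‖z - z'‖)
    (hlim : ∀ z, ∀ ε > 0, ∀ᶠ N in atTop, ∀ i, ‖B N i z‖ ≤ ε)
    {K : Set E} (hK : TotallyBounded K) {ε : ℝ} (hε : 0 < ε) :
    ∀ᶠ N in atTop, ∀ i, ∀ z ∈ K, ‖B N i z‖ ≤ ε := by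
  have hδ : 0 < ε / 2 / (|b| + 1) := by positivity
  obtain ⟨t, ht, hKt⟩ := Metric.totallyBounded_iff.1 hK _ hδ
  filter_upwards [(eventually_all_finite ht).2 fun z _ => hlim z (ε / 2) (by positivity)]
    with N hN i z hz
  obtain ⟨z', hz', hzz'⟩ := mem_iUnion₂.1 (hKt hz)
  rw [Metric.mem_ball, dist_eq_norm] at hzz'
  have h1 : ‖B N i z - B N i z'‖ ≤ ε / 2 := by
    refine (hB N i z z').trans ?_
    calc b * ‖z - z'‖ ≤ (|b| + 1) * (ε / 2 / (|b| + 1)) := by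
          gcongr
          linarith [le_abs_self b]
      _ = ε / 2 := by field_simp
  calc ‖B N i z‖ = ‖(B N i z - B N i z') + B N i z'‖ := by rw [sub_add_cancel]
    _ ≤ _ := norm_add_le _ _
    _ ≤ ε := by linarith [hN z' hz' i]

/-- For equi-Lipschitz maps, convergence to zero on a dense set implies convergence everywhere. -/
theorem eventually_norm_le_of_dense {B : ℕ → ι → E → E'} {b : ℝ}
    (hB : ∀ N i z z', ‖B N i z - B N i z'‖ ≤ b * ‖z - z'‖) {D : Set E} (hD : Dense D)
    (hlim : ∀ z ∈ D, ∀ ε > 0, ∀ᶠ N in atTop, ∀ i, ‖B N i z‖ ≤ ε) :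
    ∀ z, ∀ ε > 0, ∀ᶠ N in atTop, ∀ i, ‖B N i z‖ ≤ ε := by
  intro z ε hε
  obtain ⟨z', hz', hzz'⟩ := hD.exists_dist_lt z (ε := ε / 2 / (|b| + 1)) (by positivity)
  rw [dist_eq_norm] at hzz'
  filter_upwards [hlim z' hz' (ε / 2) (by positivity)] with N hN i
  have h1 : ‖B N i z - B N i z'‖ ≤ ε / 2 := by
    refine (hB N i z z').trans ?_
    calc b * ‖z - z'‖ ≤ (|b| + 1) * (ε / 2 / (|b| + 1)) := by
          gcongr
          linarith [le_abs_self b]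
      _ = ε / 2 := by field_simp
  calc ‖B N i z‖ = ‖(B N i z - B N i z') + B N i z'‖ := by rw [sub_add_cancel]
    _ ≤ _ := norm_add_le _ _
    _ ≤ ε := by linarith [hN i]

/-- A finite `ε/2`-net of a set within `ε/2` of `K` is an `ε`-net of `K`. The approximating set may
change with `ε`. -/
theorem totallyBounded_of_approx {K : Set E}
    (h : ∀ ε > 0, ∃ K', TotallyBounded K' ∧ ∀ z ∈ K, ∃ z' ∈ K', ‖z - z'‖ ≤ ε) :
    TotallyBounded K := by
  refine Metric.totallyBounded_iff.2 fun ε hε => ?_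
  obtain ⟨K', hK', happ⟩ := h (ε / 2) (by positivity)
  obtain ⟨t, ht, hKt⟩ := Metric.totallyBounded_iff.1 hK' (ε / 2) (by positivity)
  refine ⟨t, ht, fun z hz => ?_⟩
  obtain ⟨z', hz', hzz'⟩ := happ z hz
  obtain ⟨w, hw, hzw⟩ := mem_iUnion₂.1 (hKt hz')
  refine mem_iUnion₂.2 ⟨w, hw, ?_⟩
  rw [Metric.mem_ball] at hzw ⊢
  rw [← dist_eq_norm] at hzz'
  linarith [dist_triangle z z' w]

end OperatorFamilies

/-! ### Variation of constants for integrable forcing. -/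

section VariationOfConstants

variable {E : Type*} [NormedAddCommGroup E] [NormedSpace ℝ E]

/-- A continuous family of operators maps integrable functions to integrable functions. -/
theorem intervalIntegrable_clm_apply {G : ℝ → E →L[ℝ] E} (hG : Continuous G) {f : ℝ → E} {a b : ℝ}
    (hf : IntervalIntegrable f volume a b) :
    IntervalIntegrable (fun r => G r (f r)) volume a b := by
  rw [intervalIntegrable_iff] at hf ⊢
  obtain ⟨c, hc⟩ := isCompact_uIcc.exists_bound_of_continuousOn (s := uIcc a b) hG.continuousOn
  refine (hf.norm.const_mul c).mono' ?_ ?_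
  · have h2 : Continuous fun p : (E →L[ℝ] E) × E => p.1 p.2 := by fun_prop
    exact h2.comp_aestronglyMeasurable (hG.aestronglyMeasurable.prodMk hf.aestronglyMeasurable)
  · refine (ae_restrict_mem measurableSet_uIoc).mono fun τ hτ => ?_
    exact (G τ).le_of_opNorm_le (hc τ (uIoc_subset_uIcc hτ)) _

variable [CompleteSpace E]

/-- Integration by parts against the primitive of an integrable function. -/
theorem integral_clm_apply_primitive {G g : ℝ → E →L[ℝ] E} {s : ℝ} (hs : 0 ≤ s)
    (hG : ∀ r, HasDerivAt G (g r) r) (hg : Continuous g) {f : ℝ → E}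
    (hf : IntervalIntegrable f volume 0 s) :
    ∫ r in 0..s, g r (∫ τ in 0..r, f τ) =
      G s (∫ τ in 0..s, f τ) - ∫ τ in 0..s, G τ (f τ) := by
  have hGc : Continuous G := continuous_iff_continuousAt.2 fun r => (hG r).continuousAt
  have hf' : IntegrableOn f (Ioc 0 s) := (intervalIntegrable_iff_integrableOn_Ioc_of_le hs).1 hf
  obtain ⟨c, hc⟩ := isCompact_Icc.exists_bound_of_continuousOn (s := Icc 0 s) hg.continuousOn
  set μ : Measure ℝ := volume.restrict (Ioc 0 s)
  -- Fubini on the triangle `0 < τ ≤ r ≤ s`, encoded by an indicator so that both variables range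
  -- over `Ioc 0 s`.
  have hprod : Integrable (Function.uncurry fun r τ => (Ioc 0 r).indicator
      (fun τ => g r (f τ)) τ) (μ.prod μ) := by
    have hdom : Integrable (fun p : ℝ × ℝ => ‖c‖ * ‖f p.2‖) (μ.prod μ) := by
      have : Integrable (fun _ : ℝ => ‖c‖) μ := integrable_const _
      exact this.mul_prod hf'.norm
    have hmeas : AEStronglyMeasurable (fun p : ℝ × ℝ => g p.1 (f p.2)) (μ.prod μ) := by
      have h2 : Continuous fun p : (E →L[ℝ] E) × E => p.1 p.2 := by fun_prop
      exact h2.comp_aestronglyMeasurable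
        ((hg.comp continuous_fst).aestronglyMeasurable.prodMk hf'.aestronglyMeasurable.comp_snd)
    have hset : MeasurableSet {p : ℝ × ℝ | 0 < p.2 ∧ p.2 ≤ p.1} :=
      (measurableSet_lt measurable_const measurable_snd).inter
        (measurableSet_le measurable_snd measurable_fst)
    have heq : (Function.uncurry fun r τ => (Ioc 0 r).indicator (fun τ => g r (f τ)) τ)
        = {p : ℝ × ℝ | 0 < p.2 ∧ p.2 ≤ p.1}.indicator fun p => g p.1 (f p.2) := by
      ext ⟨r, τ⟩
      simp [Function.uncurry, indicator]
    rw [heq]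
    refine hdom.mono' (hmeas.indicator hset) ?_
    have hae : ∀ᵐ p ∂(μ.prod μ), p ∈ Ioc 0 s ×ˢ (univ : Set ℝ) := by
      have : μ.prod μ = (volume.prod μ).restrict (Ioc 0 s ×ˢ univ) := by
        rw [← Measure.prod_restrict, Measure.restrict_univ]
      rw [this]
      exact ae_restrict_mem (measurableSet_Ioc.prod MeasurableSet.univ)
    filter_upwards [hae] with p hp
    refine (norm_indicator_le_norm_self _ _).trans ?_
    refine (g p.1).le_of_opNorm_le ((hc _ ⟨hp.1.1.le, hp.1.2⟩).trans (Real.le_norm_self _)) _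
  have hswap := integral_integral_swap hprod
  have hleft : ∫ r in 0..s, g r (∫ τ in 0..r, f τ)
      = ∫ r, (∫ τ, (Ioc 0 r).indicator (fun τ => g r (f τ)) τ ∂μ) ∂μ := by
    rw [intervalIntegral.integral_of_le hs]
    refine setIntegral_congr_fun measurableSet_Ioc fun r hr => ?_
    rw [integral_indicator measurableSet_Ioc, Measure.restrict_restrict measurableSet_Ioc,
      inter_eq_left.2 (Ioc_subset_Ioc_right hr.2), intervalIntegral.integral_of_le hr.1.le,
      ContinuousLinearMap.integral_comp_comm]
    exact hf'.mono_set (Ioc_subset_Ioc_right hr.2)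
  have hright : ∫ τ, (∫ r, (Ioc 0 r).indicator (fun τ => g r (f τ)) τ ∂μ) ∂μ
      = ∫ τ in 0..s, (G s (f τ) - G τ (f τ)) := by
    rw [intervalIntegral.integral_of_le hs]
    refine setIntegral_congr_fun measurableSet_Ioc fun τ hτ => ?_
    have hind : ∀ r ∈ Ioc 0 s, (Ioc 0 r).indicator (fun τ => g r (f τ)) τ
        = (Ici τ).indicator (fun r => g r (f τ)) r := fun r hr => by
      simp [indicator, hτ.1]
    rw [setIntegral_congr_fun measurableSet_Ioc hind, setIntegral_indicator measurableSet_Ici]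
    have hI : Ioc 0 s ∩ Ici τ = Icc τ s := by
      ext r; simp only [mem_inter_iff, mem_Ioc, mem_Ici, mem_Icc]
      exact ⟨fun h => ⟨h.2, h.1.2⟩, fun h => ⟨⟨hτ.1.trans_le h.1, h.2⟩, h.1⟩⟩
    rw [hI, integral_Icc_eq_integral_Ioc, ← intervalIntegral.integral_of_le hτ.2]
    exact intervalIntegral.integral_eq_sub_of_hasDerivAt (f := fun r => G r (f τ))
      (fun r _ => by simpa using (hG r).clm_apply (hasDerivAt_const r (f τ)))
      ((hg.clm_apply continuous_const).intervalIntegrable _ _)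
  rw [hleft, hswap, hright, intervalIntegral.integral_sub,
    ContinuousLinearMap.intervalIntegral_comp_comm _ hf]
  · exact (intervalIntegrable_iff_integrableOn_Ioc_of_le hs).2 ((G s).integrable_comp hf')
  · exact intervalIntegrable_clm_apply hGc hf

/-- The variation of constants formula for a bounded generator `A`. -/
theorem variation_of_constants {P : ℝ → E →L[ℝ] E} {A : E →L[ℝ] E} (hP0 : P 0 = .id ℝ E)
    (hP : ∀ t, HasDerivAt P ((P t).comp A) t) {s : ℝ} (hs : 0 ≤ s) {x : E} {y f : ℝ → E}
    (hy : ContinuousOn y (Icc 0 s)) (hf : IntervalIntegrable f volume 0 s)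
    (h : ∀ r ∈ Icc 0 s, y r = x + ∫ τ in 0..r, (A (y τ) + f τ)) :
    y s = P s x + ∫ r in 0..s, P (s - r) (f r) := by
  have hPc : Continuous P := continuous_iff_continuousAt.2 fun r => (hP r).continuousAt
  have hG : ∀ r, HasDerivAt (fun r => P (s - r)) (-(P (s - r)).comp A) r := fun r => by
    have := (hP (s - r)).scomp r ((hasDerivAt_id r).const_sub s)
    rw [neg_one_smul] at this
    exact this
  have hPs : Continuous fun r => P (s - r) := hPc.comp (by fun_prop)
  have hAc : Continuous fun r => (P (s - r)).comp A := hPs.clm_comp continuous_const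
  have hAn : Continuous fun r => -(P (s - r)).comp A := hAc.neg
  have hAx : IntervalIntegrable (fun r => (-(P (s - r)).comp A) x) volume 0 s :=
    (hAn.clm_apply continuous_const).intervalIntegrable _ _
  have hAy : IntervalIntegrable (fun r => A (y r)) volume 0 s :=
    (A.continuous.comp_continuousOn hy).intervalIntegrable_of_Icc hs
  -- Integration by parts with `G r = P (s - r)` against the integrand `A y + f`, whose primitive is
  -- `y - x`. The terms `∫ P (s - r) A y` on the two sides cancel, and `G s = P 0` is the identity.
  -- No derivative of `y` is needed.
  have h1 := integral_clm_apply_primitive hs hG hAn (hAy.add hf)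
  have hcong : ∫ r in 0..s, (-(P (s - r)).comp A) (∫ τ in 0..r, (A (y τ) + f τ))
      = ∫ r in 0..s, ((-(P (s - r)).comp A) (y r) - (-(P (s - r)).comp A) x) := by
    refine intervalIntegral.integral_congr fun r hr => ?_
    rw [uIcc_of_le hs] at hr
    rw [← map_sub, h r hr, add_sub_cancel_left]
  have hyint : IntervalIntegrable (fun r => (-(P (s - r)).comp A) (y r)) volume 0 s :=
    (hAn.continuousOn.clm_apply hy).intervalIntegrable_of_Icc hs
  have hx : ∫ r in 0..s, (-(P (s - r)).comp A) x = x - P s x := by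
    have := intervalIntegral.integral_eq_sub_of_hasDerivAt (a := 0) (b := s)
      (f := fun r => P (s - r) x) (f' := fun r => (-(P (s - r)).comp A) x)
      (fun r _ => by simpa using (hG r).clm_apply (hasDerivAt_const r x)) hAx
    simpa [hP0] using this
  have hfint := intervalIntegrable_clm_apply hPs hf
  have hsplit : ∫ τ in 0..s, P (s - τ) (A (y τ) + f τ)
      = -(∫ r in 0..s, (-(P (s - r)).comp A) (y r)) + ∫ r in 0..s, P (s - r) (f r) := by
    rw [← intervalIntegral.integral_neg, ← intervalIntegral.integral_add (f := fun r =>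
      -(-(P (s - r)).comp A) (y r)) hyint.neg hfint]
    simp
  have h3 : (∫ τ in 0..s, (A (y τ) + f τ)) = y s - x := by
    rw [h s ⟨hs, le_rfl⟩, add_sub_cancel_left]
  rw [hcong, intervalIntegral.integral_sub hyint hAx, hx, h3, hsplit, sub_self,
    hP0] at h1
  simp only [ContinuousLinearMap.id_apply] at h1
  have h4 := congrArg (fun v => (P s x + ∫ r in 0..s, P (s - r) (f r)) + x -
    (∫ r in 0..s, (-(P (s - r)).comp A) (y r)) - (P s x) + v) h1
  simp only at h4
  abel_nf at h4 ⊢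
  exact h4.symm

end VariationOfConstants

/-! ### `C₀`-semigroups and their generators. -/

section SemigroupTheory

variable {𝕜 H : Type*} [RCLike 𝕜] [NormedAddCommGroup H] [InnerProductSpace 𝕜 H]
  {S : ℝ → H →L[𝕜] H} {M ω : ℝ}

theorem norm_apply_le_of_exp_bound (hM : 0 ≤ M) (hω : 0 ≤ ω)
    (hSb : ∀ t : ℝ, 0 ≤ t → ‖S t‖ ≤ M * Real.exp (ω * t)) {t T : ℝ} (ht : 0 ≤ t) (htT : t ≤ T)
    (z : H) : ‖S t z‖ ≤ M * Real.exp (ω * T) * ‖z‖ := by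
  refine (S t).le_of_opNorm_le ((hSb t ht).trans ?_) z
  gcongr

/-- For `a ≤ b`, `S b - S a = S a (S (b - a) - 1)`; with the local bound on `S a`, right continuity
at `0` gives continuity from both sides. Truncating at `0` discards the arbitrary values at negative
times. -/
theorem IsC0Semigroup.continuous_apply (hS : IsC0Semigroup S) (hM : 0 ≤ M) (hω : 0 ≤ ω)
    (hSb : ∀ t : ℝ, 0 ≤ t → ‖S t‖ ≤ M * Real.exp (ω * t)) (x : H) :
    Continuous fun t : ℝ => S (max t 0) x := by
  have hle : ∀ a b T : ℝ, 0 ≤ a → a ≤ b → b ≤ T →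
      ‖S b x - S a x‖ ≤ M * Real.exp (ω * T) * ‖S |b - a| x - x‖ := by
    intro a b T ha hab hb
    have : S b x - S a x = S a (S |b - a| x - x) := by
      rw [abs_of_nonneg (sub_nonneg.2 hab), map_sub, ← ContinuousLinearMap.comp_apply,
        ← hS.add a (b - a) ha (sub_nonneg.2 hab), add_sub_cancel]
    rw [this]
    exact norm_apply_le_of_exp_bound hM hω hSb ha (hab.trans hb) _
  have h0 : Tendsto (fun h : ℝ => S |h| x) (𝓝 0) (𝓝 x) := by
    have h1 : ContinuousWithinAt (fun h => S h x) (Ioi 0) 0 := by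
      simpa [ContinuousWithinAt, hS.zero] using hS.continuous_at_zero x
    rw [continuousWithinAt_Ioi_iff_Ici, ContinuousWithinAt, hS.zero] at h1
    refine h1.comp (tendsto_nhdsWithin_iff.2 ⟨?_, Eventually.of_forall fun h => abs_nonneg h⟩)
    simpa using (continuous_abs.tendsto (0 : ℝ))
  refine continuous_iff_continuousAt.2 fun t₀ => ?_
  rw [ContinuousAt, tendsto_iff_norm_sub_tendsto_zero]
  have h1 : Tendsto (fun t : ℝ => max t 0 - max t₀ 0) (𝓝 t₀) (𝓝 0) := by
    have : Continuous fun t : ℝ => max t 0 - max t₀ 0 := by fun_prop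
    simpa using this.tendsto t₀
  have h2 : Tendsto (fun t : ℝ => M * Real.exp (ω * (max t₀ 0 + 1)) *
      ‖S |max t 0 - max t₀ 0| x - x‖) (𝓝 t₀) (𝓝 0) := by
    have := ((tendsto_iff_norm_sub_tendsto_zero.1 h0).comp h1).const_mul
      (M * Real.exp (ω * (max t₀ 0 + 1)))
    simpa using this
  refine squeeze_zero' (Eventually.of_forall fun t => norm_nonneg _) ?_ h2
  filter_upwards [h1.eventually (gt_mem_nhds one_pos)] with t ht
  rcases le_total (max t 0) (max t₀ 0) with h | h
  · rw [norm_sub_rev, abs_sub_comm]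
    exact hle _ _ _ (le_max_right _ _) h (by linarith)
  · exact hle _ _ _ (le_max_right _ _) h (by linarith)

/-- A `C₀`-semigroup is jointly continuous. -/
theorem IsC0Semigroup.continuous_uncurry (hS : IsC0Semigroup S) (hM : 0 ≤ M) (hω : 0 ≤ ω)
    (hSb : ∀ t : ℝ, 0 ≤ t → ‖S t‖ ≤ M * Real.exp (ω * t)) :
    Continuous fun p : ℝ × H => S (max p.1 0) p.2 := by
  refine continuous_iff_continuousAt.2 fun ⟨t₀, x₀⟩ => ?_
  rw [ContinuousAt, tendsto_iff_norm_sub_tendsto_zero]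
  have h1 : Tendsto (fun p : ℝ × H => M * Real.exp (ω * max p.1 0) * ‖p.2 - x₀‖
      + ‖S (max p.1 0) x₀ - S (max t₀ 0) x₀‖) (𝓝 (t₀, x₀)) (𝓝 0) := by
    have : Continuous fun p : ℝ × H => M * Real.exp (ω * max p.1 0) * ‖p.2 - x₀‖
        + ‖S (max p.1 0) x₀ - S (max t₀ 0) x₀‖ := by
      have := (hS.continuous_apply hM hω hSb x₀).comp (continuous_fst (X := ℝ) (Y := H))
      have h3 : Continuous fun p : ℝ × H => S (max p.1 0) x₀ := this
      exact ((by fun_prop : Continuous fun p : ℝ × H => M * Real.exp (ω * max p.1 0) *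
        ‖p.2 - x₀‖)).add (h3.sub continuous_const).norm
    simpa using this.tendsto (t₀, x₀)
  refine squeeze_zero (fun _ => norm_nonneg _) (fun p => ?_) h1
  calc ‖S (max p.1 0) p.2 - S (max t₀ 0) x₀‖
      = ‖S (max p.1 0) (p.2 - x₀) + (S (max p.1 0) x₀ - S (max t₀ 0) x₀)‖ := by
        rw [map_sub]; abel_nf
    _ ≤ _ := (norm_add_le _ _).trans (by
        gcongr
        exact norm_apply_le_of_exp_bound hM hω hSb (le_max_right _ _) le_rfl _)

variable {L : H →ₗ.[𝕜] H}

/-- The domain of the generator is invariant under the semigroup, which commutes with the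
generator there. -/
theorem IsGenerator.apply_semigroup (hL : IsGenerator S L) (hS : IsC0Semigroup S) (φ : L.domain)
    {r : ℝ} (hr : 0 ≤ r) : ∃ h : S r φ ∈ L.domain, L ⟨S r φ, h⟩ = S r (L φ) := by
  refine (hL _ _).2 ?_
  have h1 := ((S r).continuous.tendsto _).comp ((hL φ (L φ)).1 ⟨φ.2, rfl⟩)
  refine h1.congr' ?_
  filter_upwards [self_mem_nhdsWithin] with h hh
  have h2 : S h (S r φ) = S r (S h φ) := by
    rw [← ContinuousLinearMap.comp_apply, ← ContinuousLinearMap.comp_apply,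
      ← hS.add h r (le_of_lt hh) hr, ← hS.add r h hr (le_of_lt hh), add_comm]
  simp only [Function.comp, map_smul, map_sub, h2]

/-- Pointwise bounded operators on the domain of a closed operator are bounded in the graph norm. -/
theorem exists_graph_bound [CompleteSpace H] (hcl : IsClosed (L.graph : Set (H × H))) {A : ℕ → H →L[𝕜] H}
    (hA : ∀ φ : L.domain, ∃ c, ∀ N, ‖A N φ‖ ≤ c) :
    ∃ c, ∀ N, ∀ φ : L.domain, ‖A N φ‖ ≤ c * max ‖(φ : H)‖ ‖L φ‖ := by
  -- The graph is a Banach space, so the uniform boundedness principle applies to `A N` composed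
  -- with the first projection.
  have : CompleteSpace L.graph := hcl.completeSpace_coe
  obtain ⟨c, hc⟩ := banach_steinhaus (g := fun N => (A N).comp
    ((ContinuousLinearMap.fst 𝕜 H H).comp L.graph.subtypeL)) (fun p => by
      obtain ⟨φ, h1, h2⟩ := (LinearPMap.mem_graph_iff L).1 p.2
      obtain ⟨c, hc⟩ := hA φ
      exact ⟨c, fun N => by simpa [← h1] using hc N⟩)
  refine ⟨c, fun N φ => ?_⟩
  have := ContinuousLinearMap.le_of_opNorm_le _ (hc N) ⟨((φ : H), L φ), L.mem_graph φ⟩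
  simpa using this

variable [NormedSpace ℝ H]

theorem IsGenerator.tendsto_real (hL : IsGenerator S L) (φ : L.domain) :
    Tendsto (fun h : ℝ => h⁻¹ • (S h φ - φ)) (𝓝[>] 0) (𝓝 (L φ)) := by
  have := (hL φ (L φ)).1 ⟨φ.2, rfl⟩
  simpa only [← RCLike.real_smul_eq_coe_smul] using this

/-- The increment is `(S (t - r) - 1) S r φ` with `S r φ` in the domain. A right derivative is
enough for the fundamental theorem of calculus. -/
theorem IsGenerator.hasDerivWithinAt (hL : IsGenerator S L) (hS : IsC0Semigroup S) (φ : L.domain)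
    {r : ℝ} (hr : 0 ≤ r) :
    HasDerivWithinAt (fun t => S t φ) (S r (L φ)) (Ioi r) r := by
  rw [hasDerivWithinAt_iff_tendsto_slope' (by simp)]
  obtain ⟨h1, h2⟩ := hL.apply_semigroup hS φ hr
  have h3 := hL.tendsto_real ⟨S r φ, h1⟩
  rw [h2] at h3
  have h4 : Tendsto (fun t : ℝ => t - r) (𝓝[>] r) (𝓝[>] 0) := by
    refine tendsto_nhdsWithin_iff.2 ⟨?_, ?_⟩
    · have : Continuous fun t : ℝ => t - r := by fun_prop
      simpa using (this.tendsto r).mono_left nhdsWithin_le_nhds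
    · filter_upwards [self_mem_nhdsWithin] with t ht using sub_pos.2 (mem_Ioi.1 ht)
  refine (h3.comp h4).congr' ?_
  filter_upwards [self_mem_nhdsWithin] with t ht
  have ht : 0 ≤ t - r := sub_nonneg.2 (le_of_lt ht)
  simp only [Function.comp, slope, vsub_eq_sub]
  rw [← ContinuousLinearMap.comp_apply, ← hS.add _ _ ht hr, sub_add_cancel]

variable [CompleteSpace H]

theorem IsGenerator.sub_eq_integral (hL : IsGenerator S L) (hS : IsC0Semigroup S) (hM : 0 ≤ M)
    (hω : 0 ≤ ω) (hSb : ∀ t : ℝ, 0 ≤ t → ‖S t‖ ≤ M * Real.exp (ω * t)) (φ : L.domain) {h : ℝ}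
    (hh : 0 ≤ h) : S h φ - φ = ∫ r in 0..h, S (max r 0) (L φ) := by
  rw [intervalIntegral.integral_eq_sub_of_hasDeriv_right_of_le (f := fun t => S (max t 0) φ) hh
    (hS.continuous_apply hM hω hSb _).continuousOn (fun r hr => ?_)
    ((hS.continuous_apply hM hω hSb _).intervalIntegrable _ _)]
  · simp [hh, hS.zero]
  · rw [max_eq_left hr.1.le]
    refine (hL.hasDerivWithinAt hS φ hr.1.le).congr (fun t ht => ?_) ?_
    · rw [max_eq_left (hr.1.trans ht).le]
    · rw [max_eq_left hr.1.le]

/-- The generator of a `C₀`-semigroup is closed. -/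
theorem IsGenerator.isClosed_graph (hL : IsGenerator S L) (hS : IsC0Semigroup S) (hM : 0 ≤ M)
    (hω : 0 ≤ ω) (hSb : ∀ t : ℝ, 0 ≤ t → ‖S t‖ ≤ M * Real.exp (ω * t)) :
    IsClosed (L.graph : Set (H × H)) := by
  have hc := fun x => hS.continuous_apply hM hω hSb x
  -- The integrated identity characterises the graph: differentiating it at `h = 0` recovers the
  -- generator. Each condition is closed in `(x, y)`.
  have hset : (L.graph : Set (H × H)) =
      ⋂ h ∈ Ici (0 : ℝ), {p | S h p.1 - p.1 = ∫ r in 0..h, S (max r 0) p.2} := by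
    ext ⟨x, y⟩
    simp only [SetLike.mem_coe, LinearPMap.mem_graph_iff, mem_iInter, mem_ofPred_eq]
    constructor
    · rintro ⟨φ, rfl, rfl⟩ h hh
      exact hL.sub_eq_integral hS hM hω hSb φ hh
    · intro hxy
      obtain ⟨hx, hLx⟩ := (hL x y).2 <| by
        simp only [← RCLike.real_smul_eq_coe_smul]
        have h1 : HasDerivAt (fun h => ∫ r in 0..h, S (max r 0) y) (S (max 0 0) y) 0 :=
          ((hc y).integral_hasStrictDerivAt 0 0).hasDerivAt
        have h2 := (hasDerivWithinAt_iff_tendsto_slope' (by simp)).1 (h1.hasDerivWithinAt (s := Ioi 0))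
        rw [max_self, hS.zero] at h2
        refine h2.congr' ?_
        filter_upwards [self_mem_nhdsWithin] with h hh
        simp [slope, hxy h (mem_Ici.2 (le_of_lt hh))]
      exact ⟨⟨x, hx⟩, rfl, hLx⟩
  rw [hset]
  refine isClosed_biInter fun h (hh : 0 ≤ h) => isClosed_eq (by fun_prop) ?_
  refine Continuous.comp (g := fun y => ∫ r in 0..h, S (max r 0) y) ?_ continuous_snd
  refine (LipschitzWith.of_dist_le_mul (K := (M * Real.exp (ω * h) * h).toNNReal)
    fun a b => ?_).continuous
  rw [dist_eq_norm, dist_eq_norm, ← intervalIntegral.integral_sub ((hc a).intervalIntegrable _ _)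
    ((hc b).intervalIntegrable _ _), Real.coe_toNNReal _ (by positivity)]
  calc _ ≤ M * Real.exp (ω * h) * ‖a - b‖ * |h - 0| := by
        refine intervalIntegral.norm_integral_le_of_norm_le_const fun r hr => ?_
        rw [uIoc_of_le hh] at hr
        rw [← map_sub]
        exact norm_apply_le_of_exp_bound hM hω hSb (le_max_right _ _) (by simp [hr.2, hh]) _
    _ = _ := by rw [sub_zero, abs_of_nonneg hh]; ring

end SemigroupTheory

/-! ### The exponential flow of a bounded operator. -/

section ExpFlow

variable {𝕜 H : Type*} [RCLike 𝕜] [NormedAddCommGroup H] [InnerProductSpace 𝕜 H]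
  [NormedSpace ℝ H]

/-- The flow `t ↦ e^{t A}` of a bounded operator, as a family of real-linear operators. -/
noncomputable def expFlow (A : H →L[𝕜] H) (t : ℝ) : H →L[ℝ] H :=
  (NormedSpace.exp ((t : 𝕜) • A)).restrictScalars ℝ

theorem expFlow_apply (A : H →L[𝕜] H) (t : ℝ) (z : H) :
    expFlow A t z = NormedSpace.exp ((t : 𝕜) • A) z := rfl

theorem expFlow_zero (A : H →L[𝕜] H) : expFlow A 0 = .id ℝ H := by
  ext z
  simp [expFlow_apply]

variable [CompleteSpace H]

theorem hasDerivAt_expFlow (A : H →L[𝕜] H) (t : ℝ) :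
    HasDerivAt (expFlow A) ((expFlow A t).comp (A.restrictScalars ℝ)) t := by
  have h1 := hasDerivAt_exp_smul_const (𝕂 := 𝕜) A (t : 𝕜)
  have h2 : HasDerivAt (fun t : ℝ => (t : 𝕜)) (1 : 𝕜) t := by
    simpa using (RCLike.ofRealCLM (K := 𝕜)).hasDerivAt (x := t)
  have h3 := h1.scomp t h2
  rw [one_smul] at h3
  exact (ContinuousLinearMap.restrictScalarsL 𝕜 H H ℝ ℝ).hasFDerivAt.comp_hasDerivAt t h3

theorem continuous_expFlow (A : H →L[𝕜] H) : Continuous (expFlow A) :=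
  continuous_iff_continuousAt.2 fun t => (hasDerivAt_expFlow A t).continuousAt

end ExpFlow

/-! ### The Trotter–Kato theorem. -/

section TrotterKato

variable {𝕜 H : Type*} [RCLike 𝕜] [NormedAddCommGroup H] [InnerProductSpace 𝕜 H]
  [NormedSpace ℝ H] [CompleteSpace H]
  {S : ℝ → H →L[𝕜] H} {M ω T : ℝ} {L : H →ₗ.[𝕜] H} {A Q : ℕ → H →L[𝕜] H}

/-- The Duhamel estimate comparing a `C₀`-semigroup with the flow of a bounded operator. -/
theorem norm_sub_expFlow_le (hS : IsC0Semigroup S) (hL : IsGenerator S L) (hM : 0 ≤ M) (hω : 0 ≤ ω)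
    (hSb : ∀ t : ℝ, 0 ≤ t → ‖S t‖ ≤ M * Real.exp (ω * t)) {A Q : H →L[𝕜] H}
    (hQQ : ∀ z, Q (Q z) = Q z) (hQA : ∀ z, Q (A z) = A z) (hAQ : ∀ z, A (Q z) = A z)
    (hE : ∀ t, 0 ≤ t → t ≤ T → ∀ z, ‖expFlow A t (Q z)‖ ≤ M * Real.exp (ω * T) * ‖z‖)
    (φ : L.domain) {t : ℝ} (ht : 0 ≤ t) (htT : t ≤ T) :
    ‖Q (S t φ) - expFlow A t (Q φ)‖ ≤ M * Real.exp (ω * T) *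
      ∫ r in 0..T, ‖Q (S (max r 0) (L φ)) - A (S (max r 0) φ)‖ := by
  have hc := fun x => hS.continuous_apply hM hω hSb x
  have hP : Continuous fun r => expFlow A (t - r) :=
    (continuous_expFlow A).comp (by fun_prop)
  have hPd : ∀ r, HasDerivAt (fun r => expFlow A (t - r))
      (-(expFlow A (t - r)).comp (A.restrictScalars ℝ)) r := fun r => by
    have := (hasDerivAt_expFlow A (t - r)).scomp r ((hasDerivAt_id r).const_sub t)
    rw [neg_one_smul] at this
    exact this
  set d : ℝ → H := fun r => Q (S (max r 0) (L φ)) - A (S (max r 0) φ) with hd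
  have hdc : Continuous d :=
    (Q.continuous.comp (hc (L φ))).sub (A.continuous.comp (hc φ))
  -- The function `r ↦ e^{(t-r)A} Q S(r)φ` joins `e^{tA} Qφ` to `Q S(t)φ`; since `AQ = A`, its right
  -- derivative is `e^{(t-r)A} d(r)`.
  have key : ∫ r in 0..t, expFlow A (t - r) (d r) = Q (S t φ) - expFlow A t (Q φ) := by
    rw [intervalIntegral.integral_eq_sub_of_hasDeriv_right_of_le
      (f := fun r => expFlow A (t - r) (Q (S (max r 0) φ))) ht
      (hP.clm_apply (Q.continuous.comp (hc φ))).continuousOn (fun r hr => ?_)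
      ((hP.clm_apply hdc).intervalIntegrable _ _)]
    · simp [ht, hS.zero, expFlow_zero]
    · have h1 : HasDerivWithinAt (fun t => S (max t 0) φ) (S r (L φ)) (Ioi r) r := by
        refine (hL.hasDerivWithinAt hS φ hr.1.le).congr (fun t ht => ?_) ?_
        · rw [max_eq_left (hr.1.trans ht).le]
        · rw [max_eq_left hr.1.le]
      have h2 := ((Q.restrictScalars ℝ).hasFDerivAt.comp_hasDerivWithinAt r h1)
      have h3 := (hPd r).hasDerivWithinAt.clm_apply h2
      refine h3.congr_deriv ?_
      simp [hd, max_eq_left hr.1.le, hAQ, sub_eq_neg_add]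
  rw [← key]
  have hnn : ∀ r, 0 ≤ ‖d r‖ := fun r => norm_nonneg _
  calc ‖∫ r in 0..t, expFlow A (t - r) (d r)‖
      ≤ ∫ r in 0..t, M * Real.exp (ω * T) * ‖d r‖ := by
        refine intervalIntegral.norm_integral_le_of_norm_le ht ?_
          ((hdc.norm.const_mul _).intervalIntegrable _ _)
        refine Eventually.of_forall fun r hr => ?_
        -- The stability bound `hE` only controls the flow after `Q`, but `d r` is in the range of
        -- `Q`.
        have hQd : expFlow A (t - r) (d r) = expFlow A (t - r) (Q (d r)) := by
          simp only [hd, map_sub, hQQ, hQA]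
        rw [hQd]
        exact hE _ (sub_nonneg.2 hr.2) (by linarith [hr.1]) _
    _ ≤ M * Real.exp (ω * T) * ∫ r in 0..T, ‖d r‖ := by
        rw [intervalIntegral.integral_const_mul]
        gcongr
        exact intervalIntegral.integral_mono_interval le_rfl ht htT
          (Eventually.of_forall hnn) (hdc.norm.intervalIntegrable _ _)

/-- The Trotter–Kato approximation theorem for flows of bounded operators `A N` living on the
ranges of projectors `Q N`. -/
theorem trotter_kato (hS : IsC0Semigroup S) (hL : IsGenerator S L) (hM : 0 ≤ M) (hω : 0 ≤ ω)
    (hSb : ∀ t : ℝ, 0 ≤ t → ‖S t‖ ≤ M * Real.exp (ω * t))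
    (hdense : Dense (L.domain : Set H))
    (hQQ : ∀ N z, Q N (Q N z) = Q N z)
    (hQA : ∀ N z, Q N (A N z) = A N z) (hAQ : ∀ N z, A N (Q N z) = A N z)
    (hQ1 : ∀ N z, ‖Q N z‖ ≤ ‖z‖) (hQ : ∀ z, Tendsto (fun N => Q N z) atTop (𝓝 z))
    (hA : ∀ φ : L.domain, Tendsto (fun N => A N φ) atTop (𝓝 (L φ)))
    (hE : ∀ N, ∀ t, 0 ≤ t → t ≤ T → ∀ z,
      ‖expFlow (A N) t (Q N z)‖ ≤ M * Real.exp (ω * T) * ‖z‖) (hT : 0 ≤ T) :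
    ∀ z, ∀ ε > 0, ∀ᶠ N in atTop, ∀ t : Icc 0 T,
      ‖S t z - expFlow (A N) t (Q N z)‖ ≤ ε := by
  have hc := fun x => hS.continuous_apply hM hω hSb x
  set c := M * Real.exp (ω * T)
  have hc0 : 0 ≤ c := by positivity
  refine eventually_norm_le_of_dense (B := fun N (t : Icc 0 T) z =>
    S t z - expFlow (A N) t (Q N z)) (b := 2 * c) (fun N t z z' => ?_) hdense fun φ₀ hφ₀ ε hε => ?_
  · have : S t z - expFlow (A N) t (Q N z) - (S t z' - expFlow (A N) t (Q N z'))
        = S t (z - z') - expFlow (A N) t (Q N (z - z')) := by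
      simp only [map_sub]; abel
    rw [this]
    refine (norm_sub_le _ _).trans ?_
    linarith [norm_apply_le_of_exp_bound hM hω hSb t.2.1 t.2.2 (z - z'), hE N t t.2.1 t.2.2 (z - z')]
  set φ : L.domain := ⟨φ₀, hφ₀⟩
  obtain ⟨B, hB⟩ := exists_graph_bound (hL.isClosed_graph hS hM hω hSb) (A := A) fun φ => by
    obtain ⟨c, hc⟩ := (hA φ).norm.bddAbove_range
    exact ⟨c, fun N => hc ⟨N, rfl⟩⟩
  have hK : TotallyBounded ((fun r => S (max r 0) φ) '' Icc 0 T) :=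
    (isCompact_Icc.image (hc φ)).totallyBounded
  -- The error splits into `(1 - Q) S(t)φ`, uniformly small because the orbit is compact, and the
  -- Duhamel remainder.
  have h1 := eventually_norm_le_of_totallyBounded (ι := Unit) (B := fun N _ z => z - Q N z) (b := 2)
    (fun N _ z z' => by
      have : z - Q N z - (z' - Q N z') = (z - z') - Q N (z - z') := by
        simp only [map_sub]; abel
      rw [this]
      refine (norm_sub_le _ _).trans ?_
      linarith [hQ1 N (z - z')])
    (fun z ε hε => by
      have := (tendsto_iff_norm_sub_tendsto_zero.1 (hQ z)).eventually (gt_mem_nhds hε)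
      filter_upwards [this] with N hN _
      rw [norm_sub_rev]
      exact hN.le) hK (half_pos hε)
  -- Dominated convergence: pointwise, both terms tend to `L S(r)φ`; the graph-norm bound dominates,
  -- as `L S(r)φ = S(r) Lφ` is bounded in `r`.
  have h2 : Tendsto (fun N => c * ∫ r in 0..T, ‖Q N (S (max r 0) (L φ)) - A N (S (max r 0) φ)‖)
      atTop (𝓝 0) := by
    have : Tendsto (fun N => ∫ r in 0..T, ‖Q N (S (max r 0) (L φ)) - A N (S (max r 0) φ)‖)
        atTop (𝓝 (∫ r in 0..T, (0 : ℝ))) := by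
      refine intervalIntegral.tendsto_integral_filter_of_dominated_convergence
        (fun _ => c * ‖L φ‖ + |B| * (c * max ‖(φ : H)‖ ‖L φ‖)) ?_ ?_
        (intervalIntegrable_const) ?_
      · refine Eventually.of_forall fun N => Continuous.aestronglyMeasurable ?_
        exact (((Q N).continuous.comp (hc (L φ))).sub ((A N).continuous.comp (hc φ))).norm
      · refine Eventually.of_forall fun N => Eventually.of_forall fun r hr => ?_
        rw [uIoc_of_le hT] at hr
        rw [norm_norm, max_eq_left hr.1.le]
        obtain ⟨hm, hLm⟩ := hL.apply_semigroup hS φ hr.1.le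
        have hb := fun z => norm_apply_le_of_exp_bound hM hω hSb hr.1.le hr.2 z
        refine (norm_sub_le _ _).trans (add_le_add ((hQ1 N _).trans (hb _)) ?_)
        refine (hB N ⟨S r φ, hm⟩).trans ?_
        rw [hLm, mul_max_of_nonneg _ _ hc0]
        gcongr
        · exact le_abs_self B
        · exact hb _
        · exact hb _
      · refine Eventually.of_forall fun r hr => ?_
        rw [uIoc_of_le hT] at hr
        rw [max_eq_left hr.1.le]
        obtain ⟨hm, hLm⟩ := hL.apply_semigroup hS φ hr.1.le
        have := ((hQ (S r (L φ))).sub (hA ⟨S r φ, hm⟩)).norm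
        simpa [hLm] using this
    simpa using this.const_mul c
  filter_upwards [h1, h2.eventually (gt_mem_nhds (half_pos hε))] with N hN1 hN2 t
  have h3 := hN1 () (S t φ) ⟨t, t.2, by simp [t.2.1]⟩
  have h4 := norm_sub_expFlow_le hS hL hM hω hSb (hQQ N) (hQA N) (hAQ N) (hE N) φ t.2.1 t.2.2
  calc ‖S t φ₀ - expFlow (A N) t (Q N φ₀)‖
      = ‖(S t φ - Q N (S t φ)) + (Q N (S t φ) - expFlow (A N) t (Q N φ))‖ := by
        rw [sub_add_sub_cancel]
    _ ≤ _ := norm_add_le _ _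
    _ ≤ ε := by linarith

end TrotterKato

/-! ### Admissible controls and their time shifts. -/

section Controls

variable {V E : Type*} [NormedAddCommGroup V] [NormedAddCommGroup E] {q : ℝ≥0∞} {U : Set V}
  {t T : ℝ} {w : ℝ → V}

theorem integrableOn_comp_control {C : V → E} (hC : Continuous C) (hU : IsCompact U)
    (hw : AEStronglyMeasurable w (volume.restrict (Icc t T)))
    (hwU : ∀ᵐ s ∂(volume.restrict (Icc t T)), w s ∈ U) :
    IntegrableOn (fun r => C (w r)) (Icc t T) := by
  obtain ⟨c, hc⟩ := hU.exists_bound_of_continuousOn hC.continuousOn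
  refine (integrable_const c).mono' (hC.comp_aestronglyMeasurable hw) ?_
  filter_upwards [hwU] with r hr using hc _ hr

theorem admissibleOn_aestronglyMeasurable (ht : 0 ≤ t) (hw : w ∈ admissibleOn q U t T) :
    AEStronglyMeasurable w (volume.restrict (Icc t T)) := by
  obtain ⟨u, hu, hwu⟩ := hw
  exact (hu.1.1.mono_measure (Measure.restrict_mono (Icc_subset_Icc_left ht) le_rfl)).congr hwu.symm

theorem admissibleOn_ae_mem (ht : 0 ≤ t) (hw : w ∈ admissibleOn q U t T) :
    ∀ᵐ s ∂(volume.restrict (Icc t T)), w s ∈ U := by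
  obtain ⟨u, hu, hwu⟩ := hw
  filter_upwards [hwu, ae_mono (Measure.restrict_mono (Icc_subset_Icc_left ht) le_rfl) hu.2]
    with s h1 h2
  rwa [h1]

/-- A control on `[t, T]` is the time shift of an admissible control on `[0, T]`. -/
theorem exists_admissible_shift (hU : IsCompact U) (hT : 0 < T) (ht : 0 ≤ t)
    (hw : w ∈ admissibleOn q U t T) :
    ∃ u ∈ admissible q U T, ∀ᵐ r ∂(volume.restrict (Icc t T)), w r = u (r - t) := by
  obtain ⟨u, ⟨huLp, huU⟩, hwu⟩ := hw
  have hne : volume.restrict (Icc 0 T) ≠ 0 := by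
    rw [Ne, Measure.restrict_eq_zero, Real.volume_Icc]
    simp [hT]
  have : NeBot (ae (volume.restrict (Icc 0 T))) := ae_neBot.2 hne
  obtain ⟨s₀, hs₀⟩ := huU.exists
  set v := huLp.1.mk u
  have hv : StronglyMeasurable v := huLp.1.stronglyMeasurable_mk
  have huv : u =ᵐ[volume.restrict (Icc 0 T)] v := huLp.1.ae_eq_mk
  -- The tail takes a value `u s₀ ∈ U`, as `0` need not lie in `U`. The strongly measurable
  -- representative `v` keeps the shifted function measurable.
  set w' : ℝ → V := fun s => if s ≤ T - t then v (s + t) else u s₀ with hw'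
  have hw'm : StronglyMeasurable w' :=
    StronglyMeasurable.ite (measurableSet_le measurable_id measurable_const)
      (hv.comp_measurable (measurable_id.add_const t)) stronglyMeasurable_const
  have hw'U : ∀ᵐ s ∂(volume.restrict (Icc 0 T)), w' s ∈ U := by
    have h1 := huU.and huv
    rw [ae_restrict_iff' measurableSet_Icc] at h1 ⊢
    filter_upwards [(measurePreserving_add_right volume t).quasiMeasurePreserving.ae h1] with s hs hsI
    simp only [hw']
    split_ifs with h
    · obtain ⟨h2, h3⟩ := hs ⟨add_nonneg hsI.1 ht, by linarith⟩
      rwa [← h3]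
    · exact hs₀
  obtain ⟨c, hc⟩ := hU.exists_bound_of_continuousOn continuous_id.continuousOn
  refine ⟨w', ⟨MemLp.of_bound hw'm.aestronglyMeasurable c ?_, hw'U⟩, ?_⟩
  · filter_upwards [hw'U] with s hs using hc _ hs
  · have h1 := ae_mono (Measure.restrict_mono (Icc_subset_Icc_left ht) le_rfl) huv
    filter_upwards [h1, hwu, ae_restrict_mem measurableSet_Icc] with r h2 h3 hr
    simp [hw', hr.2, h3, h2]

end Controls

/-! ### Lipschitz constants on balls. -/

section Nonlinearity

variable {E E' : Type*} [NormedAddCommGroup E] [NormedAddCommGroup E'] {F : E → E'}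

theorem LipschitzOnBalls.exists_bound (hF : LipschitzOnBalls F) (c : ℝ) :
    ∃ K : ℝ, 0 < K ∧ ∀ a b, ‖a‖ ≤ c → ‖b‖ ≤ c → ‖F a - F b‖ ≤ K * ‖a - b‖ := by
  -- The radius must be positive whatever the sign of `c`; `K + 1` below gives the strict positivity
  -- that Grönwall needs.
  obtain ⟨K, hK⟩ := hF (|c| + 1) (by positivity)
  refine ⟨K + 1, by positivity, fun a b ha hb => ?_⟩
  have h1 := hK.norm_sub_le (x := a) (y := b) (by simp; linarith [le_abs_self c])
    (by simp; linarith [le_abs_self c])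
  nlinarith [norm_nonneg (a - b)]

theorem LipschitzOnBalls.continuous (hF : LipschitzOnBalls F) : Continuous F := by
  refine continuous_iff_continuousAt.2 fun x => ?_
  obtain ⟨K, hK⟩ := hF (‖x‖ + 1) (by positivity)
  refine hK.continuousOn.continuousAt (mem_of_superset (Metric.ball_mem_nhds x one_pos) fun y hy => ?_)
  rw [Metric.mem_ball, dist_eq_norm] at hy
  rw [mem_closedBall_zero_iff]
  linarith [norm_le_norm_add_norm_sub' y x]

theorem LipschitzOnBalls.exists_bound_of_continuousOn (hF : LipschitzOnBalls F) {y₁ y₂ : ℝ → E}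
    {t T : ℝ} (h₁ : ContinuousOn y₁ (Icc t T)) (h₂ : ContinuousOn y₂ (Icc t T)) :
    ∃ K : ℝ, 0 < K ∧ ∀ r ∈ Icc t T, ‖F (y₁ r) - F (y₂ r)‖ ≤ K * ‖y₁ r - y₂ r‖ := by
  obtain ⟨c₁, hc₁⟩ := isCompact_Icc.exists_bound_of_continuousOn h₁
  obtain ⟨c₂, hc₂⟩ := isCompact_Icc.exists_bound_of_continuousOn h₂
  obtain ⟨K, hK, h⟩ := hF.exists_bound (max c₁ c₂)
  exact ⟨K, hK, fun r hr => h _ _ ((hc₁ r hr).trans (le_max_left _ _))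
    ((hc₂ r hr).trans (le_max_right _ _))⟩

end Nonlinearity

/-! ### Time translation and uniqueness. -/

section WellPosedness

variable {𝕜 H V : Type*} [RCLike 𝕜] [NormedAddCommGroup H] [InnerProductSpace 𝕜 H]
  {S : ℝ → H →L[𝕜] H} {F : H → H} {C : V → H} {M ω t T : ℝ} {x : H} {w u : ℝ → V}
  {L : H →ₗ.[𝕜] H} {K : Submodule 𝕜 H} [FiniteDimensional 𝕜 K] {hK : K ≤ L.domain}

theorem eqOn_of_norm_sub_le_integral {y₁ y₂ : ℝ → H} {b : ℝ} (hb : 0 < b)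
    (h₁ : ContinuousOn y₁ (Icc t T)) (h₂ : ContinuousOn y₂ (Icc t T))
    (h : ∀ s ∈ Icc t T, ‖y₁ s - y₂ s‖ ≤ ∫ r in t..s, b * ‖y₁ r - y₂ r‖) :
    EqOn y₁ y₂ (Icc t T) := by
  intro s hs
  have := le_mul_exp_of_le_add_integral (a := 0) hb (h₁.sub h₂).norm (fun _ _ => norm_nonneg _)
    (fun s hs => by simpa using h s hs) s hs
  rw [zero_mul] at this
  exact sub_eq_zero.1 (norm_le_zero_iff.1 this)

theorem continuousOn_shift {z : ℝ → H} (hz : ContinuousOn z (Icc 0 T)) (ht : 0 ≤ t) :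
    ContinuousOn (fun s => z (s - t)) (Icc t T) :=
  hz.comp (by fun_prop) fun s hs => ⟨sub_nonneg.2 hs.1, by linarith [hs.2]⟩

theorem IsC0Semigroup.continuousOn_convolution (hS : IsC0Semigroup S) (hM : 0 ≤ M) (hω : 0 ≤ ω)
    (hSb : ∀ t : ℝ, 0 ≤ t → ‖S t‖ ≤ M * Real.exp (ω * t)) {g : ℝ → H} {s : ℝ}
    (hg : ContinuousOn g (Icc t s)) : ContinuousOn (fun r => S (s - r) (g r)) (Icc t s) := by
  have h1 : ContinuousOn (fun r => S (max (s - r) 0) (g r)) (Icc t s) :=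
    (hS.continuous_uncurry hM hω hSb).comp_continuousOn
      (ContinuousOn.prodMk (f := fun r => s - r) (by fun_prop) hg)
  refine h1.congr fun r hr => ?_
  simp only
  rw [max_eq_left (sub_nonneg.2 hr.2)]

theorem IsC0Semigroup.integrableOn_convolution (hS : IsC0Semigroup S) (hM : 0 ≤ M) (hω : 0 ≤ ω)
    (hSb : ∀ t : ℝ, 0 ≤ t → ‖S t‖ ≤ M * Real.exp (ω * t)) {g : ℝ → H} {s : ℝ}
    (hg : IntegrableOn g (Icc t s)) : IntegrableOn (fun r => S (s - r) (g r)) (Icc t s) := by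
  have h1 : AEStronglyMeasurable (fun r => S (max (s - r) 0) (g r)) (volume.restrict (Icc t s)) :=
    (hS.continuous_uncurry hM hω hSb).comp_aestronglyMeasurable
      (AEStronglyMeasurable.prodMk (f := fun r => s - r)
        (by fun_prop : Continuous fun r => s - r).aestronglyMeasurable hg.aestronglyMeasurable)
  have h2 : AEStronglyMeasurable (fun r => S (s - r) (g r)) (volume.restrict (Icc t s)) := by
    refine h1.congr ?_
    filter_upwards [ae_restrict_mem measurableSet_Icc] with r hr
    rw [max_eq_left (sub_nonneg.2 hr.2)]
  refine (hg.norm.const_mul (M * Real.exp (ω * (s - t)))).mono' h2 ?_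
  filter_upwards [ae_restrict_mem measurableSet_Icc] with r hr
  exact norm_apply_le_of_exp_bound hM hω hSb (sub_nonneg.2 hr.2) (by linarith [hr.1]) _

variable [NormedSpace ℝ H]

theorem integral_shift_congr {g g' : ℝ → H} {s : ℝ} (hs : s ∈ Icc t T)
    (h : ∀ᵐ r ∂(volume.restrict (Icc t T)), g r = g' (r - t)) :
    ∫ r in t..s, g r = ∫ r in 0..(s - t), g' r := by
  have h1 := intervalIntegral.integral_comp_sub_right (a := t) (b := s) g' t
  rw [sub_self] at h1
  rw [← h1]
  refine intervalIntegral.integral_congr_ae ?_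
  rw [ae_restrict_iff' measurableSet_Icc] at h
  filter_upwards [h] with r hr hrs
  rw [uIoc_of_le hs.1] at hrs
  exact hr ⟨hrs.1.le, hrs.2.trans hs.2⟩

theorem IsMildSolution.shift {z : ℝ → H} (hz : IsMildSolution S F C 0 T x u z) (ht : 0 ≤ t)
    (hw : ∀ᵐ r ∂(volume.restrict (Icc t T)), w r = u (r - t)) :
    IsMildSolution S F C t T x w (fun s => z (s - t)) := by
  refine ⟨continuousOn_shift hz.continuousOn ht, fun s hs => ?_⟩
  rw [hz.eq (s - t) ⟨sub_nonneg.2 hs.1, by linarith [hs.2]⟩, sub_zero,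
    integral_shift_congr (g' := fun r => S (s - t - r) (F (z r))) hs (by simp),
    integral_shift_congr (g' := fun r => S (s - t - r) (C (u r))) hs]
  filter_upwards [hw] with r hr
  simp [hr]

theorem IsGalerkinSolution.shift {z : ℝ → H} (hz : IsGalerkinSolution L K hK F C 0 T x u z)
    (ht : 0 ≤ t) (hw : ∀ᵐ r ∂(volume.restrict (Icc t T)), w r = u (r - t)) :
    IsGalerkinSolution L K hK F C t T x w (fun s => z (s - t)) := by
  have hmem : ∀ s ∈ Icc t T, s - t ∈ Icc 0 T := fun s hs =>
    ⟨sub_nonneg.2 hs.1, by linarith [hs.2]⟩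
  refine ⟨continuousOn_shift hz.continuousOn ht, fun s hs => hz.mem _ (hmem s hs), fun s hs => ?_⟩
  rw [hz.eq (s - t) (hmem s hs), integral_shift_congr (g' := fun r => galerkinOp L K hK (z r) +
    K.starProjection (F (z r)) + K.starProjection (C (u r))) hs]
  filter_upwards [hw] with r hr
  simp [hr]

/-- Uniqueness on `[t, T]` does not follow by translation, since solutions there only move to `[0, T
- t]`. The control terms cancel and Grönwall handles the rest, with a Lipschitz constant for the
compact ranges of the two solutions. -/
theorem IsMildSolution.eqOn (hS : IsC0Semigroup S) (hM : 0 < M) (hω : 0 ≤ ω)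
    (hSb : ∀ t : ℝ, 0 ≤ t → ‖S t‖ ≤ M * Real.exp (ω * t)) (hF : LipschitzOnBalls F)
    {y₁ y₂ : ℝ → H} (h₁ : IsMildSolution S F C t T x w y₁) (h₂ : IsMildSolution S F C t T x w y₂) :
    EqOn y₁ y₂ (Icc t T) := by
  obtain ⟨K, hK, hlip⟩ := hF.exists_bound_of_continuousOn h₁.continuousOn h₂.continuousOn
  refine eqOn_of_norm_sub_le_integral (b := M * Real.exp (ω * (T - t)) * K) (by positivity)
    h₁.continuousOn h₂.continuousOn fun s hs => ?_
  have hsub : Icc t s ⊆ Icc t T := Icc_subset_Icc_right hs.2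
  have hint : ∀ {y : ℝ → H}, ContinuousOn y (Icc t T) →
      IntervalIntegrable (fun r => S (s - r) (F (y r))) volume t s := fun hy =>
    (hS.continuousOn_convolution hM.le hω hSb
      (hF.continuous.comp_continuousOn (hy.mono hsub))).intervalIntegrable_of_Icc hs.1
  rw [h₁.eq s hs, h₂.eq s hs, add_sub_add_right_eq_sub, add_sub_add_left_eq_sub,
    ← intervalIntegral.integral_sub (hint h₁.continuousOn) (hint h₂.continuousOn)]
  refine intervalIntegral.norm_integral_le_of_norm_le hs.1 (Eventually.of_forall fun r hr => ?_)
    ((((h₁.continuousOn.sub h₂.continuousOn).norm.mono hsub).intervalIntegrable_of_Icc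
      hs.1).const_mul _)
  rw [← map_sub, mul_assoc]
  refine (norm_apply_le_of_exp_bound hM.le hω hSb (T := T - t) (sub_nonneg.2 hr.2)
    (by linarith [hr.1, hs.2]) _).trans ?_
  gcongr
  exact hlip r ⟨hr.1.le, hr.2.trans hs.2⟩

/-- Again by Grönwall. Here the control shares one integral with the other terms, so integrability
of `C ∘ w` is needed to subtract the integrals. -/
theorem IsGalerkinSolution.eqOn (hF : LipschitzOnBalls F)
    (hw : IntegrableOn (fun r => C (w r)) (Icc t T))
    {y₁ y₂ : ℝ → H} (h₁ : IsGalerkinSolution L K hK F C t T x w y₁)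
    (h₂ : IsGalerkinSolution L K hK F C t T x w y₂) :
    EqOn y₁ y₂ (Icc t T) := by
  obtain ⟨k, hk, hlip⟩ := hF.exists_bound_of_continuousOn h₁.continuousOn h₂.continuousOn
  set A := galerkinOp L K hK
  refine eqOn_of_norm_sub_le_integral (b := ‖A‖ + k) (by positivity)
    h₁.continuousOn h₂.continuousOn fun s hs => ?_
  have hsub : Icc t s ⊆ Icc t T := Icc_subset_Icc_right hs.2
  have hint : ∀ {y : ℝ → H}, ContinuousOn y (Icc t T) →
      IntervalIntegrable (fun r => A (y r) + K.starProjection (F (y r))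
        + K.starProjection (C (w r))) volume t s := fun hy => by
    refine IntervalIntegrable.add (ContinuousOn.intervalIntegrable_of_Icc hs.1 ?_) ?_
    · exact ((A.continuous.comp_continuousOn hy).add (K.starProjection.continuous.comp_continuousOn
        (hF.continuous.comp_continuousOn hy))).mono hsub
    · rw [intervalIntegrable_iff_integrableOn_Icc_of_le hs.1]
      exact K.starProjection.integrable_comp (hw.mono_set hsub)
  rw [h₁.eq s hs, h₂.eq s hs, add_sub_add_left_eq_sub,
    ← intervalIntegral.integral_sub (hint h₁.continuousOn) (hint h₂.continuousOn)]
  refine intervalIntegral.norm_integral_le_of_norm_le hs.1 (Eventually.of_forall fun r hr => ?_)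
    ((((h₁.continuousOn.sub h₂.continuousOn).norm.mono hsub).intervalIntegrable_of_Icc
      hs.1).const_mul _)
  rw [add_sub_add_right_eq_sub, add_sub_add_comm, ← map_sub, ← map_sub, add_mul]
  refine (norm_add_le _ _).trans (add_le_add (A.le_opNorm _) ?_)
  exact (K.norm_starProjection_apply_le _).trans (hlip r ⟨hr.1.le, hr.2.trans hs.2⟩)

end WellPosedness

/-! ### Projections and the Galerkin operator. -/

section GalerkinOperator

variable {𝕜 H : Type*} [RCLike 𝕜] [NormedAddCommGroup H] [InnerProductSpace 𝕜 H]
  {L : H →ₗ.[𝕜] H} {K : Submodule 𝕜 H} [FiniteDimensional 𝕜 K] {hK : K ≤ L.domain}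

theorem starProjection_idem (z : H) :
    K.starProjection (K.starProjection z) = K.starProjection z :=
  K.starProjection_eq_self_iff.2 (K.starProjection_apply_mem z)

theorem starProjection_galerkinOp (z : H) :
    K.starProjection (galerkinOp L K hK z) = galerkinOp L K hK z :=
  starProjection_idem _

theorem galerkinOp_starProjection (z : H) :
    galerkinOp L K hK (K.starProjection z) = galerkinOp L K hK z := by
  have : K.orthogonalProjectionOnto (K.starProjection z) = K.orthogonalProjectionOnto z :=
    Subtype.ext (starProjection_idem z)
  simp only [galerkinOp, ContinuousLinearMap.comp_apply, this]

/-- The extended semigroup agrees with `e^{tA}` only on `K`, so its bound transfers to the flow only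
after projecting. -/
theorem norm_expFlow_starProjection_le [NormedSpace ℝ H]
    {A : H →L[𝕜] H} {SN : ℝ → H →L[𝕜] H} {M ω T : ℝ} (hM : 0 ≤ M) (hω : 0 ≤ ω)
    (hflow : ∀ t : ℝ, 0 ≤ t → ∀ z ∈ K, SN t z = NormedSpace.exp ((t : 𝕜) • A) z)
    (hb : ∀ t : ℝ, 0 ≤ t → ‖SN t‖ ≤ M * Real.exp (ω * t)) {t : ℝ} (ht : 0 ≤ t) (htT : t ≤ T)
    (z : H) : ‖expFlow A t (K.starProjection z)‖ ≤ M * Real.exp (ω * T) * ‖z‖ := by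
  rw [expFlow_apply, ← hflow t ht _ (K.starProjection_apply_mem z)]
  refine (norm_apply_le_of_exp_bound hM hω hb ht htT _).trans ?_
  gcongr
  exact K.norm_starProjection_apply_le z

end GalerkinOperator

/-! ### The error estimate for one control. -/

section ErrorEstimate

variable {𝕜 H V : Type*} [RCLike 𝕜] [NormedAddCommGroup H] [InnerProductSpace 𝕜 H]
  [NormedSpace ℝ H] [CompleteSpace H]
  {S : ℝ → H →L[𝕜] H} {F : H → H} {C : V → H} {M ω T : ℝ} {x : H} {u : ℝ → V} {U : Set V}
  {L : H →ₗ.[𝕜] H} {K : Submodule 𝕜 H} [FiniteDimensional 𝕜 K] {hK : K ≤ L.domain}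

/-- The variation of constants formula for the Galerkin solution. -/
theorem IsGalerkinSolution.eq_expFlow {yN : ℝ → H}
    (hyN : IsGalerkinSolution L K hK F C 0 T x u yN) (hF : Continuous F)
    (hu : IntegrableOn (fun r => C (u r)) (Icc 0 T)) {s : ℝ} (hs : s ∈ Icc 0 T) :
    yN s = expFlow (galerkinOp L K hK) s (K.starProjection x) +
      ∫ r in 0..s, expFlow (galerkinOp L K hK) (s - r)
        (K.starProjection (F (yN r)) + K.starProjection (C (u r))) := by
  have hsub : Icc 0 s ⊆ Icc 0 T := Icc_subset_Icc_right hs.2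
  refine variation_of_constants (expFlow_zero _) (hasDerivAt_expFlow (galerkinOp L K hK)) hs.1
    (hyN.continuousOn.mono hsub) ?_ fun r hr => ?_
  · refine IntervalIntegrable.add (ContinuousOn.intervalIntegrable_of_Icc hs.1 ?_) ?_
    · exact K.starProjection.continuous.comp_continuousOn
        (hF.comp_continuousOn (hyN.continuousOn.mono hsub))
    · rw [intervalIntegrable_iff_integrableOn_Icc_of_le hs.1]
      exact K.starProjection.integrable_comp (hu.mono_set hsub)
  · rw [hyN.eq r (hsub hr)]
    simp [add_assoc]

/-- The semigroup error is tested only at `x`, `F (y r)` and `C v`, never along `yN`; this is what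
allows a test set independent of `N`. The `ε` comes from the initial datum, `2 * ε * T` from the two
integrals. -/
theorem norm_mild_sub_galerkin_le (hS : IsC0Semigroup S) (hM : 0 ≤ M) (hω : 0 ≤ ω)
    (hSb : ∀ t : ℝ, 0 ≤ t → ‖S t‖ ≤ M * Real.exp (ω * t)) (hF : Continuous F)
    (hu : IntegrableOn (fun r => C (u r)) (Icc 0 T))
    (huU : ∀ᵐ s ∂(volume.restrict (Icc 0 T)), u s ∈ U) {y yN : ℝ → H}
    (hy : IsMildSolution S F C 0 T x u y) (hyN : IsGalerkinSolution L K hK F C 0 T x u yN)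
    {k m ε : ℝ} (hk : 0 < k) (hm : 0 < m) (hε : 0 ≤ ε)
    (hlip : ∀ r ∈ Icc 0 T, ‖F (y r) - F (yN r)‖ ≤ k * ‖y r - yN r‖)
    (hE : ∀ t ∈ Icc 0 T, ∀ z,
      ‖expFlow (galerkinOp L K hK) t (K.starProjection z)‖ ≤ m * ‖z‖)
    (hx : ∀ t ∈ Icc 0 T,
      ‖S t x - expFlow (galerkinOp L K hK) t (K.starProjection x)‖ ≤ ε)
    (hFy : ∀ t ∈ Icc 0 T, ∀ r ∈ Icc 0 T,
      ‖S t (F (y r)) - expFlow (galerkinOp L K hK) t (K.starProjection (F (y r)))‖ ≤ ε)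
    (hCU : ∀ t ∈ Icc 0 T, ∀ v ∈ U,
      ‖S t (C v) - expFlow (galerkinOp L K hK) t (K.starProjection (C v))‖ ≤ ε) :
    ∀ s ∈ Icc 0 T, ‖y s - yN s‖ ≤ (ε + 2 * ε * T) * Real.exp (m * k * T) := by
  intro s₀ hs₀
  set P := expFlow (galerkinOp L K hK)
  set Q := K.starProjection
  have hφ : ContinuousOn (fun r => ‖y r - yN r‖) (Icc 0 T) :=
    (hy.continuousOn.sub hyN.continuousOn).norm
  have hT : 0 ≤ T := hs₀.1.trans hs₀.2
  suffices h : ∀ s ∈ Icc 0 T, ‖y s - yN s‖ ≤ (ε + 2 * ε * T) + m * k * ∫ r in 0..s, ‖y r - yN r‖ by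
    refine (le_mul_exp_of_le_add_integral (by positivity) hφ (fun _ _ => norm_nonneg _) h
      s₀ hs₀).trans ?_
    rw [sub_zero]
    gcongr
    exact hs₀.2
  intro s hs
  have hsub : Icc 0 s ⊆ Icc 0 T := Icc_subset_Icc_right hs.2
  have hPc : Continuous fun r => P (s - r) := (continuous_expFlow _).comp (by fun_prop)
  have hy' := hy.continuousOn.mono hsub
  have hyN' := hyN.continuousOn.mono hsub
  have hi1 : IntervalIntegrable (fun r => S (s - r) (F (y r))) volume 0 s :=
    (hS.continuousOn_convolution hM hω hSb
      (hF.comp_continuousOn hy')).intervalIntegrable_of_Icc hs.1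
  have hi2 : IntervalIntegrable (fun r => S (s - r) (C (u r))) volume 0 s := by
    rw [intervalIntegrable_iff_integrableOn_Icc_of_le hs.1]
    exact hS.integrableOn_convolution hM hω hSb (hu.mono_set hsub)
  have hi3 : IntervalIntegrable (fun r => P (s - r) (Q (F (yN r)) + Q (C (u r)))) volume 0 s := by
    have h1 : IntervalIntegrable (fun r => Q (F (yN r)) + Q (C (u r))) volume 0 s := by
      refine IntervalIntegrable.add (ContinuousOn.intervalIntegrable_of_Icc hs.1 ?_) ?_
      · exact Q.continuous.comp_continuousOn (hF.comp_continuousOn hyN')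
      · rw [intervalIntegrable_iff_integrableOn_Icc_of_le hs.1]
        exact Q.integrable_comp (hu.mono_set hsub)
    exact intervalIntegrable_clm_apply hPc h1
  have hdiff : y s - yN s = (S s x - P s (Q x)) +
      ∫ r in 0..s, (S (s - r) (F (y r)) + S (s - r) (C (u r))
        - P (s - r) (Q (F (yN r)) + Q (C (u r)))) := by
    rw [intervalIntegral.integral_sub (hi1.add hi2) hi3, intervalIntegral.integral_add hi1 hi2,
      hy.eq s hs, hyN.eq_expFlow hF hu hs, sub_zero]
    abel
  have hbound : ‖∫ r in 0..s, (S (s - r) (F (y r)) + S (s - r) (C (u r))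
        - P (s - r) (Q (F (yN r)) + Q (C (u r))))‖ ≤
      ∫ r in 0..s, (2 * ε + m * k * ‖y r - yN r‖) := by
    have hφi : IntervalIntegrable (fun r => ‖y r - yN r‖) volume 0 s :=
      (hφ.mono hsub).intervalIntegrable_of_Icc hs.1
    refine intervalIntegral.norm_integral_le_of_norm_le hs.1 ?_
      (intervalIntegrable_const.add (hφi.const_mul _))
    rw [ae_restrict_iff' measurableSet_Icc] at huU
    filter_upwards [huU] with r hr hrs
    have hrT : r ∈ Icc 0 T := ⟨hrs.1.le, hrs.2.trans hs.2⟩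
    have hsr : s - r ∈ Icc 0 T := ⟨sub_nonneg.2 hrs.2, by linarith [hrs.1, hs.2]⟩
    have h1 := hFy _ hsr _ hrT
    have h2 := hCU _ hsr _ (hr hrT)
    have h3 := (hE _ hsr (F (y r) - F (yN r))).trans (mul_le_mul_of_nonneg_left (hlip r hrT) hm.le)
    have heq : S (s - r) (F (y r)) + S (s - r) (C (u r)) - P (s - r) (Q (F (yN r)) + Q (C (u r)))
        = (S (s - r) (F (y r)) - P (s - r) (Q (F (y r))))
          + (S (s - r) (C (u r)) - P (s - r) (Q (C (u r))))
          + P (s - r) (Q (F (y r) - F (yN r))) := by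
      simp only [map_sub, map_add]; abel
    rw [heq]
    refine (norm_add₃_le).trans ?_
    linarith
  have hint : ∫ r in 0..s, (2 * ε + m * k * ‖y r - yN r‖)
      = s * (2 * ε) + m * k * ∫ r in 0..s, ‖y r - yN r‖ := by
    rw [intervalIntegral.integral_add intervalIntegrable_const
      (IntervalIntegrable.const_mul ((hφ.mono hsub).intervalIntegrable_of_Icc hs.1) _),
      intervalIntegral.integral_const_mul (m * k), intervalIntegral.integral_const, sub_zero, smul_eq_mul]
  rw [hdiff]
  refine (norm_add_le _ _).trans ?_
  have h5 : s * (2 * ε) ≤ 2 * ε * T := by nlinarith [hs.2]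
  linarith [hx s hs]

end ErrorEstimate

/-! ### Compactness of trajectories and uniformity in the control. -/

section UniformConvergence

variable {𝕜 H V : Type*} [RCLike 𝕜] [NormedAddCommGroup H] [InnerProductSpace 𝕜 H]
  [NormedAddCommGroup V]

/-- Bounded sets whose residual energy vanishes uniformly are totally bounded. -/
theorem totallyBounded_of_residual {HN : ℕ → Submodule 𝕜 H} [∀ N, FiniteDimensional 𝕜 (HN N)]
    {s : Set H} {c : ℝ} (hc : ∀ z ∈ s, ‖z‖ ≤ c)
    (h : ∀ ε > 0, ∃ N, ∀ z ∈ s, ‖z - (HN N).starProjection z‖ ≤ ε) : TotallyBounded s := by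
  refine totallyBounded_of_approx fun ε hε => ?_
  obtain ⟨N, hN⟩ := h ε hε
  have := FiniteDimensional.proper_rclike 𝕜 (HN N)
  refine ⟨((↑) : HN N → H) '' Metric.closedBall 0 c,
    ((isCompact_closedBall _ _).image continuous_subtype_val).totallyBounded, fun z hz => ?_⟩
  refine ⟨(HN N).starProjection z, ⟨⟨_, (HN N).starProjection_apply_mem z⟩, ?_, rfl⟩, hN z hz⟩
  rw [mem_closedBall_zero_iff]
  exact ((HN N).norm_starProjection_apply_le z).trans (hc z hz)

/-- Continuity alone does not preserve total boundedness; completeness of `E` makes the closure of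
`s` compact. -/
theorem totallyBounded_image_of_continuous {E E' : Type*} [NormedAddCommGroup E] [CompleteSpace E]
    [NormedAddCommGroup E'] {s : Set E} (hs : TotallyBounded s) {f : E → E'} (hf : Continuous f) :
    TotallyBounded (f '' s) :=
  ((hs.closure.isCompact_of_isClosed isClosed_closure).image hf).totallyBounded.subset
    (image_mono subset_closure)

variable [NormedSpace ℝ H] [CompleteSpace H] {T : ℝ} {S : ℝ → H →L[𝕜] H} {L : H →ₗ.[𝕜] H}
  {M ω : ℝ} {F : H → H} {C : V → H} {q : ℝ≥0∞} {U : Set V} {HN : ℕ → Submodule 𝕜 H}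
  [∀ N, FiniteDimensional 𝕜 (HN N)] {hdom : ∀ N, HN N ≤ L.domain}

/-- Convergence of the Galerkin approximations on `[0, T]`, uniformly in the control. -/
theorem eventually_norm_mild_sub_galerkin_le
    (hHN : ∀ x : H, Tendsto (fun N => (HN N).starProjection x) atTop (𝓝 x))
    (hS : IsC0Semigroup S) (hL : IsGenerator S L) (hM : 0 < M) (hω : 0 ≤ ω)
    (hSb : ∀ t : ℝ, 0 ≤ t → ‖S t‖ ≤ M * Real.exp (ω * t)) (hT : 0 ≤ T)
    (hstab : ∀ N, ∃ SN : ℝ → H →L[𝕜] H,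
      (∀ t : ℝ, 0 ≤ t → ∀ z ∈ HN N,
        SN t z = NormedSpace.exp ((t : 𝕜) • galerkinOp L (HN N) (hdom N)) z) ∧
      ∀ t : ℝ, 0 ≤ t → ‖SN t‖ ≤ M * Real.exp (ω * t))
    (hcons : ∀ φ : L.domain,
      Tendsto (fun N => galerkinOp L (HN N) (hdom N) (φ : H)) atTop (𝓝 (L φ)))
    (hF : LipschitzOnBalls F) (hC : Continuous C) (hU : IsCompact U) {x : H} {c : ℝ}
    {y : (ℝ → V) → ℝ → H}
    (hy : ∀ u ∈ admissible q U T, IsMildSolution S F C 0 T x u (y u))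
    (hbound : ∀ u ∈ admissible q U T, ∀ s ∈ Icc 0 T, ‖y u s‖ ≤ c)
    (hboundN : ∀ u ∈ admissible q U T, ∀ N z,
      IsGalerkinSolution L (HN N) (hdom N) F C 0 T x u z → ∀ s ∈ Icc 0 T, ‖z s‖ ≤ c)
    (hres : Tendsto (fun N => ⨆ u ∈ admissible q U T, ⨆ s ∈ Icc 0 T,
        ‖y u s - (HN N).starProjection (y u s)‖ₑ) atTop (𝓝 0)) {ε : ℝ} (hε : 0 < ε) :
    ∀ᶠ N in atTop, ∀ u ∈ admissible q U T, ∀ z,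
      IsGalerkinSolution L (HN N) (hdom N) F C 0 T x u z →
      ∀ s ∈ Icc 0 T, ‖y u s - z s‖ ≤ ε := by
  have hE : ∀ N, ∀ t, 0 ≤ t → t ≤ T → ∀ z, ‖expFlow (galerkinOp L (HN N) (hdom N)) t
      ((HN N).starProjection z)‖ ≤ M * Real.exp (ω * T) * ‖z‖ := fun N t ht htT z => by
    obtain ⟨SN, hflow, hb⟩ := hstab N
    exact norm_expFlow_starProjection_le hM.le hω hflow hb ht htT z
  -- Density comes from the Galerkin spaces, which lie in the domain.
  have hdense : Dense (L.domain : Set H) := fun z =>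
    mem_closure_of_tendsto (hHN z) (Eventually.of_forall fun N =>
      hdom N ((HN N).starProjection_apply_mem z))
  have hTK := trotter_kato hS hL hM.le hω hSb hdense (fun _ => starProjection_idem)
    (fun _ => starProjection_galerkinOp) (fun _ => galerkinOp_starProjection)
    (fun N => (HN N).norm_starProjection_apply_le) hHN hcons hE hT
  set Y : Set H := {z | ∃ u ∈ admissible q U T, ∃ s ∈ Icc 0 T, y u s = z} with hY
  have hYtb : TotallyBounded Y := by
    refine totallyBounded_of_residual (HN := HN) (c := c) ?_ fun ε hε => ?_
    · rintro z ⟨u, hu, s, hs, rfl⟩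
      exact hbound u hu s hs
    · obtain ⟨N, hN⟩ := (hres.eventually (Iic_mem_nhds (ENNReal.ofReal_pos.2 hε))).exists
      refine ⟨N, ?_⟩
      rintro z ⟨u, hu, s, hs, rfl⟩
      have h1 : ‖y u s - (HN N).starProjection (y u s)‖ₑ ≤ ENNReal.ofReal ε :=
        ((le_iSup₂ (f := fun s (_ : s ∈ Icc 0 T) => ‖y u s - (HN N).starProjection (y u s)‖ₑ) s
          hs).trans (le_iSup₂ (f := fun u (_ : u ∈ admissible q U T) => ⨆ s ∈ Icc 0 T,
          ‖y u s - (HN N).starProjection (y u s)‖ₑ) u hu)).trans hN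
      rwa [← ofReal_norm, ENNReal.ofReal_le_ofReal_iff hε.le] at h1
  set m := M * Real.exp (ω * T)
  have hm : 0 < m := by positivity
  obtain ⟨k, hk, hlip⟩ := hF.exists_bound c
  -- Chosen so that the Grönwall bound `(δ + 2 * δ * T) * exp (m * k * T)` equals `ε`.
  set δ := ε / ((1 + 2 * T) * Real.exp (m * k * T)) with hδdef
  have hδ : 0 < δ := by positivity
  have hset : TotallyBounded ({x} ∪ (F '' Y ∪ C '' U)) :=
    (totallyBounded_singleton x).union ((totallyBounded_image_of_continuous hYtb hF.continuous).union
      (hU.image hC).totallyBounded)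
  have hunif := eventually_norm_le_of_totallyBounded (B := fun N (t : Icc 0 T) z =>
    S t z - expFlow (galerkinOp L (HN N) (hdom N)) t ((HN N).starProjection z)) (b := 2 * m)
    (fun N t z z' => by
      rw [sub_sub_sub_comm, ← map_sub, ← map_sub, ← map_sub]
      refine (norm_sub_le _ _).trans ?_
      linarith [norm_apply_le_of_exp_bound hM.le hω hSb t.2.1 t.2.2 (z - z'),
        hE N t t.2.1 t.2.2 (z - z')]) hTK hset hδ
  filter_upwards [hunif] with N hN u hu z hz s hs
  have hfinal := norm_mild_sub_galerkin_le hS hM.le hω hSb hF.continuous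
    (integrableOn_comp_control hC hU hu.1.1 hu.2) hu.2 (hy u hu) hz hk hm hδ.le
    (fun r hr => hlip _ _ (hbound u hu r hr) (hboundN u hu N z hz r hr))
    (fun t ht => hE N t ht.1 ht.2)
    (fun t ht => hN ⟨t, ht⟩ x (Or.inl rfl))
    (fun t ht r hr => hN ⟨t, ht⟩ _ (Or.inr (Or.inl ⟨_, ⟨u, hu, r, hr, rfl⟩, rfl⟩)))
    (fun t ht v hv => hN ⟨t, ht⟩ _ (Or.inr (Or.inr ⟨v, hv, rfl⟩))) s hs
  refine hfinal.trans_eq ?_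
  rw [hδdef]
  field_simp

end UniformConvergence

end GalerkinControl

/-! ### Reduction of all initial times to time zero. -/

theorem mainTheorem3 {𝕜 H V : Type*} [RCLike 𝕜]
    [NormedAddCommGroup H] [InnerProductSpace 𝕜 H] [NormedSpace ℝ H] [CompleteSpace H]
    [TopologicalSpace.SeparableSpace H]
    [NormedAddCommGroup V] [InnerProductSpace 𝕜 V] [CompleteSpace V]
    [TopologicalSpace.SeparableSpace V]
    (T : ℝ) (hT : 0 < T)
    (S : ℝ → H →L[𝕜] H) (L : H →ₗ.[𝕜] H) (M ω : ℝ)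
    (F : H → H) (C : V → H) (q : ℝ≥0∞) (hq : 1 ≤ q) (U : Set V)
    -- the Galerkin subspaces
    (HN : ℕ → Submodule 𝕜 H) [∀ N, FiniteDimensional 𝕜 (HN N)]
    (hHN : ∀ x : H, Tendsto (fun N => (HN N).starProjection x) atTop (𝓝 x))
    (hdom : ∀ N, HN N ≤ L.domain)
    -- `L` generates the `C₀`-semigroup `S`, with `‖S t‖ ≤ M e^{ω t}`
    (hS : IsC0Semigroup S) (hL : IsGenerator S L)
    (hM : 1 ≤ M) (hω : 0 ≤ ω) (hSbound : ∀ t : ℝ, 0 ≤ t → ‖S t‖ ≤ M * Real.exp (ω * t))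
    -- the flow of `L_N` on `H_N` extends to a `C₀`-semigroup on `H` with the same bound
    (hstab : ∀ N, ∃ SN : ℝ → H →L[𝕜] H, IsC0Semigroup SN ∧
      (∀ t : ℝ, 0 ≤ t → ∀ z ∈ HN N,
        SN t z = NormedSpace.exp ((t : 𝕜) • galerkinOp L (HN N) (hdom N)) z) ∧
      ∀ t : ℝ, 0 ≤ t → ‖SN t‖ ≤ M * Real.exp (ω * t))
    -- `L_N φ → L φ` on `D(L)`
    (hcons : ∀ φ : L.domain,
      Tendsto (fun N => ‖galerkinOp L (HN N) (hdom N) (φ : H) - L φ‖) atTop (𝓝 0))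
    -- the nonlinearities
    (hF : LipschitzOnBalls F) (hC : Continuous C) (hC0 : C 0 = 0)
    -- the controls take values in a compact set
    (hU : IsCompact U)
    -- well-posedness on `[0, T]`, with bounds uniform in the control
    (hwell : ∀ x : H, ∀ u ∈ admissible q U T,
      ExistsUniqueOn 0 T (IsMildSolution S F C 0 T x u) ∧
      ∀ N, ExistsUniqueOn 0 T (IsGalerkinSolution L (HN N) (hdom N) F C 0 T x u))
    (hbound : ∀ x : H, ∃ c : ℝ, ∀ u ∈ admissible q U T,
      (∀ y, IsMildSolution S F C 0 T x u y → ∀ s ∈ Icc 0 T, ‖y s‖ ≤ c) ∧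
      ∀ N y, IsGalerkinSolution L (HN N) (hdom N) F C 0 T x u y → ∀ s ∈ Icc 0 T, ‖y s‖ ≤ c)
    -- the residual energy vanishes uniformly in the control
    (hres : ∀ (x : H) (y : (ℝ → V) → ℝ → H),
      (∀ u ∈ admissible q U T, IsMildSolution S F C 0 T x u (y u)) →
      Tendsto (fun N => ⨆ u ∈ admissible q U T, ⨆ s ∈ Icc 0 T,
        ‖y u s - (HN N).starProjection (y u s)‖ₑ) atTop (𝓝 0))
    (x : H) :
    -- the problems started at time `t` are well posed ...
    (∀ t ∈ Icc 0 T, ∀ u ∈ admissibleOn q U t T,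
      ExistsUniqueOn t T (IsMildSolution S F C t T x u) ∧
      ∀ N, ExistsUniqueOn t T (IsGalerkinSolution L (HN N) (hdom N) F C t T x u)) ∧
    -- ... and their solutions `y t u = y_{t,x}(·;u)` and `yN N t u = y^N_{t,Π_N x}(·;u)` satisfy
    ∀ (y : ℝ → (ℝ → V) → ℝ → H) (yN : ℕ → ℝ → (ℝ → V) → ℝ → H),
      (∀ t ∈ Icc 0 T, ∀ u ∈ admissibleOn q U t T, IsMildSolution S F C t T x u (y t u)) →
      (∀ N, ∀ t ∈ Icc 0 T, ∀ u ∈ admissibleOn q U t T,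
        IsGalerkinSolution L (HN N) (hdom N) F C t T x u (yN N t u)) →
      Tendsto (fun N => ⨆ t ∈ Icc 0 T, ⨆ u ∈ admissibleOn q U t T, ⨆ s ∈ Icc t T,
        ‖yN N t u s - y t u s‖ₑ) atTop (𝓝 0) := by
  have hM0 : 0 < M := one_pos.trans_le hM
  choose! y₀ hy₀ using fun u hu => (hwell x u hu).1.1
  choose! z₀ hz₀ using fun u hu N => ((hwell x u hu).2 N).1
  obtain ⟨c, hc⟩ := hbound x
  have hint : ∀ t ∈ Icc 0 T, ∀ w ∈ admissibleOn q U t T,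
      IntegrableOn (fun r => C (w r)) (Icc t T) := fun t ht w hw =>
    integrableOn_comp_control hC hU (admissibleOn_aestronglyMeasurable ht.1 hw)
      (admissibleOn_ae_mem ht.1 hw)
  refine ⟨fun t ht w hw => ?_, fun y yN hy hyN => ?_⟩
  · obtain ⟨u, hu, hwu⟩ := exists_admissible_shift hU hT ht.1 hw
    exact ⟨⟨⟨_, (hy₀ u hu).shift ht.1 hwu⟩, fun y₁ y₂ h₁ h₂ => h₁.eqOn hS hM0 hω hSbound hF h₂⟩,
      fun N => ⟨⟨_, (hz₀ u hu N).shift ht.1 hwu⟩,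
        fun y₁ y₂ h₁ h₂ => h₁.eqOn hF (hint t ht w hw) h₂⟩⟩
  · refine ENNReal.tendsto_nhds_zero.2 fun ε hε => ?_
    obtain ⟨δ, hδ, hδε⟩ := ENNReal.lt_iff_exists_nnreal_btwn.1 hε
    have hδ0 : (0 : ℝ) < δ := by exact_mod_cast hδ
    filter_upwards [eventually_norm_mild_sub_galerkin_le hHN hS hL hM0 hω hSbound hT.le
      (fun N => (hstab N).imp fun _ h => h.2)
      (fun φ => tendsto_iff_norm_sub_tendsto_zero.2 (hcons φ)) hF hC hU hy₀
      (fun u hu => (hc u hu).1 _ (hy₀ u hu)) (fun u hu => (hc u hu).2) (hres x y₀ hy₀) hδ0]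
      with N hN
    refine iSup₂_le fun t ht => iSup₂_le fun w hw => iSup₂_le fun s hs => ?_
    obtain ⟨u, hu, hwu⟩ := exists_admissible_shift hU hT ht.1 hw
    -- By uniqueness the given solutions are translates of the chosen ones on `[0, T]`, for which
    -- the estimate `hN` is uniform in the control.
    rw [(hy t ht w hw).eqOn hS hM0 hω hSbound hF ((hy₀ u hu).shift ht.1 hwu) hs,
      (hyN N t ht w hw).eqOn hF (hint t ht w hw) ((hz₀ u hu N).shift ht.1 hwu) hs]
    refine le_trans ?_ hδε.le
    rw [← ofReal_norm, norm_sub_rev, ENNReal.ofReal_le_iff_le_toReal ENNReal.coe_ne_top]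
    exact hN u hu _ (hz₀ u hu N) _ ⟨sub_nonneg.2 hs.1, by linarith [hs.2, ht.1]⟩
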